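/- Let $\mathcal V$ be an infinite set of variables, $\mathcal A$ a set of visible actions, $\tau\notin\mathcal A$ and $\mathcal A_\tau=\mathcal A\cup\{\tau\}$. The set $\mathcal E$ of process expressions is given by $E::=\mathbf 0\mid X\mid a.E\mid E+E\mid \mu X.E$ with $X\in\mathcal V$, $a\in\mathcal A_\tau$; $\mu X$ binds $X$, $FV(E)$ is the set of free variables of $E$, and $E\{F/X\}$ is capture-free substitution. **Semantics.** The transition relation $\xrightarrow{a}$ and the relation $\vartriangleright\subseteq\mathcal E\times\mathcal V$ are the smallest relations such that: $a.E\xrightarrow{a}E$; if $E_1\xrightarrow{a}E'$ or $E_2\xrightarrow{a}E'$ then $E_1+E_2\xrightarrow{a}E'$; if $E\{\mu X.E/X\}\xrightarrow{a}E'$ then $\mu X.E\xrightarrow{a}E'$; and $X\vartriangleright X$; if $E_1\vartriangleright X$ or $E_2\vartriangleright X$ then $E_1+E_2\vartriangleright X$; if $E\{\mu Y.E/Y\}\vartriangleright X$ then $\mu Y.E\vartriangleright X$. Write $\Rightarrow$ for $(\xrightarrow{\tau})^*$, and $E\,\tilde\triangleright\,X$ if $E\Rightarrow E'\vartriangleright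 X$ for some $E'$. The variable $X$ is guarded in $E$ if every free occurrence of $X$ in $E$ lies within a subexpression $a.E'$ with $a\ne\tau$. A symmetric relation $R\subseteq\mathcal E\times\mathcal E$ is a divergence-preserving branching bisimulation if for all $(E,F)\in R$: 1. whenever $E\xrightarrow{a}E'$, either $a=\tau$ and there is $F'$ with $F\Rightarrow F'$ and $(E,F'),(E',F')\in R$, or there are $F',F''$ with $F\Rightarrow F'\xrightarrow{a}F''$ and $(E,F'),(E',F'')\in R$; 2. whenever $E\vartriangleright X$, there is $F'$ with $F\Rightarrow F'$, $(E,F')\in R$ and $F'\vartriangleright X$; 3. whenever $E=E_0\xrightarrow{\tau}E_1\xrightarrow{\tau}\cdots$ is an infinite $\tau$-run, there are $j\ge 0$ and $F'$ with $F\xrightarrow{\tau}\Rightarrow F'$ and $(E_j,F')\in R$. Let $\approx^{\vartriangle}_b$ be the union of all such $R$. Write $E=^{\vartriangle}_bF$ if: whenever $E\xrightarrow{a}E'$ there is $F'$ with $F\xrightarrow{a}F'$ and $E'\approx^{\vartriangle}_bF'$; whenever $F\xrightarrow{a}F'$ there is $E'$ with $E\xrightarrow{a}E'$ and $E'\approx^{\vartriangle}_bF'$;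 and for all $X$, $E\vartriangleright X$ if and only if $F\vartriangleright X$. **Inference system.** Write $\vdash E=F$ if $E=F$ can be inferred by equational reasoning (reflexivity, symmetry, transitivity, and replacing equals by equals under prefixing, $+$ and $\mu X$) from the following axioms and rules, for all $E,F,G\in\mathcal E$, $X,Y\in\mathcal V$, $a\in\mathcal A_\tau$: - S1: $E+F=F+E$; S2: $E+(F+G)=(E+F)+G$; S3: $E+E=E$; S4: $E+\mathbf 0=E$; - B: $a.(\tau.(E+F)+F)=a.(E+F)$; - R0: $\mu X.E=\mu Y.(E\{Y/X\})$, if $Y\notin FV(\mu X.E)$; - R1: $\mu X.E=E\{\mu X.E/X\}$; - R2: from $F=E\{F/X\}$ infer $F=\mu X.E$, if $X$ is guarded in $E$; - R3: $\mu X.(X+E)=\mu X.E$; - R4: $\mu X.(\tau.(\tau.E+F)+G)=\mu X.(\tau.(E+F)+G)$, if $E\,\tilde\triangleright\,X$; - R5: $\mu X.(\tau.\mu Y.(\tau.Y+E)+F)=\mu X.(\tau.\mu Y.E+F)$, if $X\neq Y$ and $E\,\tilde\triangleright\,X$; - R6: $\mu X.\tau.E=\tau.\mu X.(E\{\tau.X/X\})$;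 - R7: $\mu X.(\tau.X+\mu Y.(\tau.Y+E))=\mu X.\mu Y.(\tau.Y+E)$; - R8: $\mu X.\mu Y.(\tau.(X+E)+F)=\mu X.\mu Y.(\tau.(Y+E)+F)$. **Theorem (Soundness).** For all $E,F\in\mathcal E$, if $\vdash E=F$ then $E=^{\vartriangle}_bF$. -/

import Mathlib

namespace FiniteState

universe u v

/-- Actions: the visible actions `vis a` (with `a : A`) and the silent move `tau`. -/
inductive Act (A : Type v) : Type v
  | tau : Act A
  | vis : A → Act A

/-- Process expressions `0 | X | a.E | E + F | μX.E` over variables `V` and visible actions `A`.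
These are raw terms: expressions differing in the names of bound variables are different. -/
inductive PExpr (V : Type u) (A : Type v) : Type (max u v)
  | nil : PExpr V A
  | var : V → PExpr V A
  | pre : Act A → PExpr V A → PExpr V A
  | sum : PExpr V A → PExpr V A → PExpr V A
  | mu : V → PExpr V A → PExpr V A

theorem exists_fresh {V : Type u} [Infinite V] (s : Finset V) : ∃ x : V, x ∉ s :=
  Infinite.exists_notMem_finset s

/-- A chosen variable outside a given finite set. -/
noncomputable def fresh {V : Type u} [Infinite V] (s : Finset V) : V :=
  Classical.choose (exists_fresh s)

theorem fresh_notMem {V : Type u} [Infinite V] (s : Finset V) : fresh s ∉ s :=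
  Classical.choose_spec (exists_fresh s)

namespace PExpr

/-- The set of free variables. -/
def fv {V : Type u} {A : Type v} [DecidableEq V] : PExpr V A → Finset V
  | nil => ∅
  | var X => {X}
  | pre _ E => fv E
  | sum E F => fv E ∪ fv F
  | mu X E => (fv E).erase X

/-- Capture-free simultaneous substitution of `σ W` for the free occurrences of `W`, for all
variables `W`. A bound variable `X` is renamed, to a fresh one, exactly when keeping it would
capture a free variable of one of the expressions substituted into `μX.E`. -/
noncomputable def subst {V : Type u} {A : Type v} [DecidableEq V] [Infinite V] :
    PExpr V A → (V → PExpr V A) → PExpr V A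
  | nil, _ => nil
  | var X, σ => σ X
  | pre a E, σ => pre a (subst E σ)
  | sum E F, σ => sum (subst E σ) (subst F σ)
  | mu X E, σ =>
      let s : Finset V := ((fv E).erase X).biUnion fun W => fv (σ W)
      let Z : V := if X ∈ s then fresh s else X
      mu Z (subst E (Function.update σ X (var Z)))

/-- `E.subst1 X F` is `E{F/X}`. -/
noncomputable def subst1 {V : Type u} {A : Type v} [DecidableEq V] [Infinite V]
    (E : PExpr V A) (X : V) (F : PExpr V A) : PExpr V A :=
  subst E (Function.update var X F)

/-- `X` is guarded in the expression: every free occurrence of `X` lies in some subexpression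
`a.E'` with `a ≠ τ`. -/
def Guarded {V : Type u} {A : Type v} (X : V) : PExpr V A → Prop
  | nil => True
  | var Y => Y ≠ X
  | pre a E => a ≠ Act.tau ∨ Guarded X E
  | sum E F => Guarded X E ∧ Guarded X F
  | mu Y E => Y = X ∨ Guarded X E

end PExpr

open PExpr

section Semantics

variable {V : Type u} {A : Type v} [DecidableEq V] [Infinite V]

/-- The transition relation `E —a→ E'`. -/
inductive Step : PExpr V A → Act A → PExpr V A → Prop
  | pre (a : Act A) (E : PExpr V A) : Step (pre a E) a E
  | sum_left {E₁ E₂ E' : PExpr V A} {a : Act A} : Step E₁ a E' → Step (sum E₁ E₂) a E'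
  | sum_right {E₁ E₂ E' : PExpr V A} {a : Act A} : Step E₂ a E' → Step (sum E₁ E₂) a E'
  | mu {X : V} {E E' : PExpr V A} {a : Act A} :
      Step (subst1 E X (mu X E)) a E' → Step (mu X E) a E'

/-- The relation `E ▷ X` between expressions and variables. -/
inductive Exposes : PExpr V A → V → Prop
  | var (X : V) : Exposes (var X) X
  | sum_left {E₁ E₂ : PExpr V A} {X : V} : Exposes E₁ X → Exposes (sum E₁ E₂) X
  | sum_right {E₁ E₂ : PExpr V A} {X : V} : Exposes E₂ X → Exposes (sum E₁ E₂) X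
  | mu {X Y : V} {E : PExpr V A} :
      Exposes (subst1 E Y (mu Y E)) X → Exposes (mu Y E) X

/-- One silent step. -/
def TauStep (E F : PExpr V A) : Prop := Step E Act.tau F

/-- `E ⇒ F`: zero or more silent steps. -/
def TauStar (E F : PExpr V A) : Prop := Relation.ReflTransGen TauStep E F

/-- One or more silent steps. -/
def TauPlus (E F : PExpr V A) : Prop := ∃ G, TauStep E G ∧ TauStar G F

/-- `E ⇒ E' ▷ X` for some `E'`. -/
def WeakExposes (E : PExpr V A) (X : V) : Prop := ∃ E', TauStar E E' ∧ Exposes E' X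

/-- `r` is an infinite silent run from `E`. -/
def IsTauRun (E : PExpr V A) (r : ℕ → PExpr V A) : Prop :=
  r 0 = E ∧ ∀ i, TauStep (r i) (r (i + 1))

/-- The operator `𝓑` on binary relations. -/
def BOp (R : PExpr V A → PExpr V A → Prop) (E F : PExpr V A) : Prop :=
  (∀ a E', Step E a E' →
    (a = Act.tau ∧ ∃ F', TauStar F F' ∧ R E F' ∧ R E' F') ∨
    (∃ F' F'', TauStar F F' ∧ Step F' a F'' ∧ R E F' ∧ R E' F'')) ∧
  (∀ X, Exposes E X → ∃ F', TauStar F F' ∧ R E F' ∧ Exposes F' X)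

/-- The operator `𝓑^△` on binary relations. -/
def BDivOp (R : PExpr V A → PExpr V A → Prop) (E F : PExpr V A) : Prop :=
  BOp R E F ∧
  ∀ r, IsTauRun E r → ∃ j F', TauPlus F F' ∧ R (r j) F'

/-- Divergence-preserving branching bisimulations. -/
def IsDivBranchingBisimulation (R : PExpr V A → PExpr V A → Prop) : Prop :=
  (∀ E F, R E F → R F E) ∧ ∀ E F, R E F → BDivOp R E F

/-- Divergence-preserving branching bisimilarity. -/
def DivBranchingBisimilar (E F : PExpr V A) : Prop :=
  ∃ R : PExpr V A → PExpr V A → Prop, IsDivBranchingBisimulation R ∧ R E F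

/-- Rooted divergence-preserving branching bisimilarity, that is, divergence-preserving
branching congruence. -/
def DivBranchingCongruent (E F : PExpr V A) : Prop :=
  (∀ a E', Step E a E' → ∃ F', Step F a F' ∧ DivBranchingBisimilar E' F') ∧
  (∀ a F', Step F a F' → ∃ E', Step E a E' ∧ DivBranchingBisimilar E' F') ∧
  (∀ X, Exposes E X ↔ Exposes F X)

/-- `⊢ E = F` in the inference system: equational reasoning (reflexivity, symmetry,
transitivity, replacement of equals in every context), S1-S4, B and R0-R8. -/
inductive Provable : PExpr V A → PExpr V A → Prop
  | refl (E : PExpr V A) : Provable E E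
  | symm {E F : PExpr V A} : Provable E F → Provable F E
  | trans {E F G : PExpr V A} : Provable E F → Provable F G → Provable E G
  | congr_pre (a : Act A) {E F : PExpr V A} : Provable E F → Provable (pre a E) (pre a F)
  | congr_sum_left {E F : PExpr V A} (D : PExpr V A) :
      Provable E F → Provable (sum E D) (sum F D)
  | congr_sum_right {E F : PExpr V A} (D : PExpr V A) :
      Provable E F → Provable (sum D E) (sum D F)
  | congr_mu (X : V) {E F : PExpr V A} : Provable E F → Provable (mu X E) (mu X F)
  | S1 (E F : PExpr V A) : Provable (sum E F) (sum F E)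
  | S2 (E F G : PExpr V A) : Provable (sum E (sum F G)) (sum (sum E F) G)
  | S3 (E : PExpr V A) : Provable (sum E E) E
  | S4 (E : PExpr V A) : Provable (sum E nil) E
  | B (a : Act A) (E F : PExpr V A) :
      Provable (pre a (sum (pre Act.tau (sum E F)) F)) (pre a (sum E F))
  | R0 (X Y : V) (E : PExpr V A) : Y ∉ fv (mu X E) →
      Provable (mu X E) (mu Y (subst1 E X (var Y)))
  | R1 (X : V) (E : PExpr V A) : Provable (mu X E) (subst1 E X (mu X E))
  | R2 (X : V) (E F : PExpr V A) : Guarded X E →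
      Provable F (subst1 E X F) → Provable F (mu X E)
  | R3 (X : V) (E : PExpr V A) : Provable (mu X (sum (var X) E)) (mu X E)
  | R4 (X : V) (E F G : PExpr V A) : WeakExposes E X →
      Provable (mu X (sum (pre Act.tau (sum (pre Act.tau E) F)) G))
        (mu X (sum (pre Act.tau (sum E F)) G))
  | R5 (X Y : V) (E F : PExpr V A) : X ≠ Y → WeakExposes E X →
      Provable (mu X (sum (pre Act.tau (mu Y (sum (pre Act.tau (var Y)) E))) F))
        (mu X (sum (pre Act.tau (mu Y E)) F))
  | R6 (X : V) (E : PExpr V A) :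
      Provable (mu X (pre Act.tau E))
        (pre Act.tau (mu X (subst1 E X (pre Act.tau (var X)))))
  | R7 (X Y : V) (E : PExpr V A) :
      Provable (mu X (sum (pre Act.tau (var X)) (mu Y (sum (pre Act.tau (var Y)) E))))
        (mu X (mu Y (sum (pre Act.tau (var Y)) E)))
  | R8 (X Y : V) (E F : PExpr V A) :
      Provable (mu X (mu Y (sum (pre Act.tau (sum (var X) E)) F)))
        (mu X (mu Y (sum (pre Act.tau (sum (var Y) E)) F)))

end Semantics

end FiniteState

namespace FiniteState

universe u v

open Relation

/-! Soundness is proved by induction on derivations: rooted bisimilarity must be a congruence that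
validates every axiom and rule. To keep bound names out of the argument, raw expressions are
translated to well-scoped terms, where substitution is plain structural recursion and R0 becomes an
identity. The translation preserves and reflects transitions and exposed variables, so results about
terms pull back.

Everything rests on an analysis of instances. A transition of `G.bind σ` comes from `G`, or from `σ
w` for some `w` that `G` exposes (`step_bind_iff`); a transition of `mu E` is an instance of a
transition of `E` itself (`step_mu_iff`). Hence bisimilar contexts filled with strongly matching
processes are bisimilar (`progress_substRel`). This yields the congruence properties and R3; R8 and
R7 follow from contracting nested recursions to one (`Cong.mu_mu`), for R7 with one more comparison
of instances. R6 is a direct strong bisimulation.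

In R4 and R5 the premise that `E` weakly exposes `X` creates a silent cycle: from `E` one can
silently return through `X` to the point where `E` was entered. Processes on such a cycle reach each
other silently and all diverge already, so they can be identified, and an additional silent step or
loop inside the cycle is unobservable (`CollapseRel.bisimilar`).

For R2, silent moves of a guarded instance are moves of the context and keep it guarded. Two
solutions of a guarded equation can therefore imitate each other through a common context,
divergences included (`progress_solutionRel`). -/

/-- Well-scoped process expressions with free variables in `W`; `mu E` binds the variable `none`
of `E`. -/
inductive Term (A : Type v) : Type u → Type (max (u + 1) v)
  | nil {W : Type u} : Term A W
  | var {W : Type u} : W → Term A W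
  | pre {W : Type u} : Act A → Term A W → Term A W
  | sum {W : Type u} : Term A W → Term A W → Term A W
  | mu {W : Type u} : Term A (Option W) → Term A W

/-! ### Renaming and substitution for well-scoped terms -/

namespace Term

/-- Renaming of free variables. -/
def rename {A : Type v} {W W' : Type u} : Term A W → (W → W') → Term A W'
  | nil, _ => nil
  | var w, f => var (f w)
  | pre a E, f => pre a (rename E f)
  | sum E F, f => sum (rename E f) (rename F f)
  | mu E, f => mu (rename E (Option.map f))

/-- A substitution, lifted under a binder. -/
def up {A : Type v} {W W' : Type u} (σ : W → Term A W') : Option W → Term A (Option W')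
  | none => var none
  | some w => rename (σ w) some

/-- Simultaneous substitution. -/
def bind {A : Type v} {W W' : Type u} : Term A W → (W → Term A W') → Term A W'
  | nil, _ => nil
  | var w, σ => σ w
  | pre a E, σ => pre a (bind E σ)
  | sum E F, σ => sum (bind E σ) (bind F σ)
  | mu E, σ => mu (bind E (up σ))

/-- The substitution of `P` for the variable `none`. -/
def single {A : Type v} {W : Type u} (P : Term A W) : Option W → Term A W
  | none => P
  | some w => var w

/-- Substitution of `P` for the variable `none`. -/
def inst {A : Type v} {W : Type u} (E : Term A (Option W)) (P : Term A W) : Term A W :=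
  bind E (single P)

section Algebra

variable {A : Type v} {W W' W'' : Type u}

theorem rename_rename (E : Term A W) (f : W → W') (g : W' → W'') :
    (E.rename f).rename g = E.rename (g ∘ f) := by
  induction E generalizing W' W'' with
  | nil => rfl
  | var w => rfl
  | pre a E ih => simp only [rename, ih]
  | sum E F ihE ihF => simp only [rename, ihE, ihF]
  | mu E ih => simp only [rename, ih, Option.map_comp_map]

theorem bind_rename (E : Term A W) (f : W → W') (σ : W' → Term A W'') :
    (E.rename f).bind σ = E.bind (σ ∘ f) := by
  induction E generalizing W' W'' with
  | nil => rfl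
  | var w => rfl
  | pre a E ih => simp only [rename, bind, ih]
  | sum E F ihE ihF => simp only [rename, bind, ihE, ihF]
  | mu E ih =>
    have h : up σ ∘ Option.map f = up (σ ∘ f) := by funext w; cases w <;> rfl
    simp only [rename, bind, ih, h]

theorem rename_bind (E : Term A W) (σ : W → Term A W') (f : W' → W'') :
    (E.bind σ).rename f = E.bind fun w => (σ w).rename f := by
  induction E generalizing W' W'' with
  | nil => rfl
  | var w => rfl
  | pre a E ih => simp only [rename, bind, ih]
  | sum E F ihE ihF => simp only [rename, bind, ihE, ihF]
  | mu E ih =>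
    have h : (fun w => (up σ w).rename (Option.map f)) = up fun w => (σ w).rename f := by
      funext w
      cases w with
      | none => rfl
      | some w => simp only [up, rename_rename]; rfl
    simp only [rename, bind, ih, h]

theorem bind_bind (E : Term A W) (σ : W → Term A W') (θ : W' → Term A W'') :
    (E.bind σ).bind θ = E.bind fun w => (σ w).bind θ := by
  induction E generalizing W' W'' with
  | nil => rfl
  | var w => rfl
  | pre a E ih => simp only [bind, ih]
  | sum E F ihE ihF => simp only [bind, ihE, ihF]
  | mu E ih =>
    have h : (fun w => (up σ w).bind (up θ)) = up fun w => (σ w).bind θ := by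
      funext w
      cases w with
      | none => rfl
      | some w => simp only [up, bind_rename, rename_bind]; rfl
    simp only [bind, ih, h]

theorem bind_var (E : Term A W) : E.bind var = E := by
  induction E with
  | nil => rfl
  | var w => rfl
  | pre a E ih => simp only [bind, ih]
  | sum E F ihE ihF => simp only [bind, ihE, ihF]
  | mu E ih =>
    rename_i W
    have h : up (var : W → Term A W) = var := by funext w; cases w <;> rfl
    simp only [bind, h, ih]

theorem rename_eq_bind (E : Term A W) (f : W → W') : E.rename f = E.bind (var ∘ f) := by
  rw [← bind_var (E.rename f), bind_rename]

theorem bind_up_bind_single (E : Term A (Option W)) (σ : W → Term A W') (P : Term A W') :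
    (E.bind (up σ)).inst P = E.bind fun o => o.elim P σ := by
  rw [inst, bind_bind]
  congr 1
  funext o
  cases o with
  | none => rfl
  | some w =>
    simp only [up, bind_rename, Option.elim]
    exact bind_var _

theorem inst_bind (E : Term A (Option W)) (P : Term A W) (σ : W → Term A W') :
    (E.inst P).bind σ = E.bind fun o => o.elim (P.bind σ) σ := by
  rw [inst, bind_bind]
  congr 1
  funext o
  cases o <;> rfl

/-- With `P` equal to `mu E` this says that unfolding a recursion commutes with substitution, which
is the recursion case of the inductions on derivations for instances. -/
theorem bind_up_inst (E : Term A (Option W)) (P : Term A W) (σ : W → Term A W') :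
    (E.bind (up σ)).inst (P.bind σ) = (E.inst P).bind σ := by
  rw [bind_up_bind_single, inst_bind]

end Algebra

/-! ### Transitions and exposed variables of instances and recursions -/

section Semantics

variable {A : Type v}

/-- The transition relation. -/
inductive Step : {W : Type u} → Term A W → Act A → Term A W → Prop
  | pre {W : Type u} (a : Act A) (E : Term A W) : Step (pre a E) a E
  | sum_left {W : Type u} {E F E' : Term A W} {a : Act A} : Step E a E' → Step (sum E F) a E'
  | sum_right {W : Type u} {E F F' : Term A W} {a : Act A} : Step F a F' → Step (sum E F) a F'
  | mu {W : Type u} {E : Term A (Option W)} {E' : Term A W} {a : Act A} :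
      Step (E.inst (mu E)) a E' → Step (mu E) a E'

/-- Unguarded occurrence of a variable. -/
inductive Exposes : {W : Type u} → Term A W → W → Prop
  | var {W : Type u} (w : W) : Exposes (var w) w
  | sum_left {W : Type u} {E F : Term A W} {w : W} : Exposes E w → Exposes (sum E F) w
  | sum_right {W : Type u} {E F : Term A W} {w : W} : Exposes F w → Exposes (sum E F) w
  | mu {W : Type u} {E : Term A (Option W)} {w : W} :
      Exposes (E.inst (mu E)) w → Exposes (mu E) w

variable {W W' : Type u}

theorem step_nil {a : Act A} {K : Term A W} : ¬Step nil a K := fun h => nomatch h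

theorem step_var {w : W} {a : Act A} {K : Term A W} : ¬Step (var w) a K := fun h => nomatch h

theorem step_pre_iff {b : Act A} {E : Term A W} {a : Act A} {K : Term A W} :
    Step (pre b E) a K ↔ a = b ∧ K = E := by
  constructor
  · rintro ⟨⟩
    exact ⟨rfl, rfl⟩
  · rintro ⟨rfl, rfl⟩
    exact .pre _ _

theorem step_sum_iff {E F : Term A W} {a : Act A} {K : Term A W} :
    Step (sum E F) a K ↔ Step E a K ∨ Step F a K := by
  constructor
  · intro h
    cases h with
    | sum_left h => exact .inl h
    | sum_right h => exact .inr h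
  · rintro (h | h)
    exacts [.sum_left h, .sum_right h]

theorem step_mu_unfold_iff {E : Term A (Option W)} {a : Act A} {K : Term A W} :
    Step (mu E) a K ↔ Step (E.inst (mu E)) a K :=
  ⟨fun h => by cases h with | mu h => exact h, .mu⟩

theorem exposes_nil {w : W} : ¬Exposes (nil : Term A W) w := fun h => nomatch h

theorem exposes_var_iff {v w : W} : Exposes (var v : Term A W) w ↔ w = v := by
  constructor
  · rintro ⟨⟩
    rfl
  · rintro rfl
    exact .var _

theorem exposes_pre {a : Act A} {E : Term A W} {w : W} : ¬Exposes (pre a E) w :=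
  fun h => nomatch h

theorem exposes_sum_iff {E F : Term A W} {w : W} :
    Exposes (sum E F) w ↔ Exposes E w ∨ Exposes F w := by
  constructor
  · intro h
    cases h with
    | sum_left h => exact .inl h
    | sum_right h => exact .inr h
  · rintro (h | h)
    exacts [.sum_left h, .sum_right h]

theorem exposes_mu_unfold_iff {E : Term A (Option W)} {w : W} :
    Exposes (mu E) w ↔ Exposes (E.inst (mu E)) w :=
  ⟨fun h => by cases h with | mu h => exact h, .mu⟩

theorem Step.bind {G G' : Term A W} {a : Act A} (h : Step G a G') (σ : W → Term A W') :
    Step (G.bind σ) a (G'.bind σ) := by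
  induction h with
  | pre a E => exact .pre _ _
  | sum_left _ ih => exact .sum_left ih
  | sum_right _ ih => exact .sum_right ih
  | mu _ ih =>
    refine .mu ?_
    have := ih
    rwa [← bind_up_inst] at this

theorem Exposes.bind_step {G : Term A W} {w : W} (h : Exposes G w) {σ : W → Term A W'} {a : Act A}
    {K : Term A W'} (hK : Step (σ w) a K) : Step (G.bind σ) a K := by
  induction h with
  | var w => exact hK
  | sum_left _ ih => exact .sum_left (ih hK)
  | sum_right _ ih => exact .sum_right (ih hK)
  | mu _ ih =>
    refine .mu ?_
    have := ih hK
    rwa [← bind_up_inst] at this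

theorem Exposes.bind {G : Term A W} {w : W} (h : Exposes G w) {σ : W → Term A W'} {y : W'}
    (hy : Exposes (σ w) y) : Exposes (G.bind σ) y := by
  induction h with
  | var w => exact hy
  | sum_left _ ih => exact .sum_left (ih hy)
  | sum_right _ ih => exact .sum_right (ih hy)
  | mu _ ih =>
    refine .mu ?_
    have := ih hy
    rwa [← bind_up_inst] at this

/-- Induction on the derivation, with `G` arbitrary because a recursion is replaced by its
unfolding. When `G` is a variable, the whole derivation belongs to the process substituted for it.
-/
theorem step_bind_iff {G : Term A W} {σ : W → Term A W'} {a : Act A} {K : Term A W'} :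
    Step (G.bind σ) a K ↔
      (∃ G', Step G a G' ∧ K = G'.bind σ) ∨ ∃ w, Exposes G w ∧ Step (σ w) a K := by
  constructor
  · intro h
    generalize hU : G.bind σ = U at h
    induction h generalizing W with
    | pre a E =>
      cases G with
      | var w =>
        simp only [Term.bind] at hU
        exact .inr ⟨w, .var w, hU ▸ .pre _ _⟩
      | pre b G =>
        cases hU
        exact .inl ⟨G, .pre _ _, rfl⟩
      | _ => cases hU
    | sum_left h ih =>
      cases G with
      | var w =>
        simp only [Term.bind] at hU
        exact .inr ⟨w, .var w, hU ▸ .sum_left h⟩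
      | sum G H =>
        cases hU
        rcases ih rfl with ⟨G', h, e⟩ | ⟨w, h, h'⟩
        exacts [.inl ⟨G', .sum_left h, e⟩, .inr ⟨w, .sum_left h, h'⟩]
      | _ => cases hU
    | sum_right h ih =>
      cases G with
      | var w =>
        simp only [Term.bind] at hU
        exact .inr ⟨w, .var w, hU ▸ .sum_right h⟩
      | sum G H =>
        cases hU
        rcases ih rfl with ⟨G', h, e⟩ | ⟨w, h, h'⟩
        exacts [.inl ⟨G', .sum_right h, e⟩, .inr ⟨w, .sum_right h, h'⟩]
      | _ => cases hU
    | mu h ih =>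
      cases G with
      | var w =>
        simp only [Term.bind] at hU
        exact .inr ⟨w, .var w, hU ▸ .mu h⟩
      | mu G =>
        cases hU
        rcases ih (bind_up_inst G (.mu G) σ).symm with ⟨G', h, e⟩ | ⟨w, h, h'⟩
        exacts [.inl ⟨G', .mu h, e⟩, .inr ⟨w, .mu h, h'⟩]
      | _ => cases hU
  · rintro (⟨G', h, rfl⟩ | ⟨w, h, h'⟩)
    exacts [h.bind σ, h.bind_step h']

theorem exposes_bind_iff {G : Term A W} {σ : W → Term A W'} {y : W'} :
    Exposes (G.bind σ) y ↔ ∃ w, Exposes G w ∧ Exposes (σ w) y := by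
  constructor
  · intro h
    generalize hU : G.bind σ = U at h
    induction h generalizing W with
    | var y =>
      cases G with
      | var w =>
        simp only [Term.bind] at hU
        exact ⟨w, .var w, hU ▸ .var _⟩
      | _ => cases hU
    | sum_left h ih =>
      cases G with
      | var w =>
        simp only [Term.bind] at hU
        exact ⟨w, .var w, hU ▸ .sum_left h⟩
      | sum G H =>
        cases hU
        obtain ⟨w, h, h'⟩ := ih rfl
        exact ⟨w, .sum_left h, h'⟩
      | _ => cases hU
    | sum_right h ih =>
      cases G with
      | var w =>
        simp only [Term.bind] at hU
        exact ⟨w, .var w, hU ▸ .sum_right h⟩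
      | sum G H =>
        cases hU
        obtain ⟨w, h, h'⟩ := ih rfl
        exact ⟨w, .sum_right h, h'⟩
      | _ => cases hU
    | mu h ih =>
      cases G with
      | var w =>
        simp only [Term.bind] at hU
        exact ⟨w, .var w, hU ▸ .mu h⟩
      | mu G =>
        cases hU
        obtain ⟨w, h, h'⟩ := ih (bind_up_inst G (.mu G) σ).symm
        exact ⟨w, .mu h, h'⟩
      | _ => cases hU
  · rintro ⟨w, h, h'⟩
    exact h.bind h'

theorem step_inst_iff {G : Term A (Option W)} {P : Term A W} {a : Act A} {K : Term A W} :
    Step (G.inst P) a K ↔ (∃ G', Step G a G' ∧ K = G'.inst P) ∨ (Exposes G none ∧ Step P a K) := by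
  rw [inst, step_bind_iff]
  refine or_congr_right ⟨?_, fun h => ⟨none, h⟩⟩
  rintro ⟨_ | w, h, h'⟩
  exacts [⟨h, h'⟩, (step_var h').elim]

theorem exposes_inst_iff {G : Term A (Option W)} {P : Term A W} {w : W} :
    Exposes (G.inst P) w ↔ Exposes G (some w) ∨ (Exposes G none ∧ Exposes P w) := by
  rw [inst, exposes_bind_iff]
  constructor
  · rintro ⟨_ | y, h, h'⟩
    · exact .inr ⟨h, h'⟩
    · cases exposes_var_iff.1 h'
      exact .inl h
  · rintro (h | h)
    exacts [⟨some w, h, .var w⟩, ⟨none, h⟩]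

/-- An exposed recursion variable only leads back to `mu E`. Derivations are well-founded, so
following it finally arrives at a transition of the body itself. -/
theorem step_mu_iff {E : Term A (Option W)} {a : Act A} {K : Term A W} :
    Step (mu E) a K ↔ ∃ E', Step E a E' ∧ K = E'.inst (mu E) := by
  constructor
  · have key : ∀ {U : Term A W}, Step U a K → ∀ G : Term A (Option W), G.inst (mu E) = U →
        ∃ G', (Step G a G' ∨ Step E a G') ∧ K = G'.inst (mu E) := by
      intro U h
      induction h with
      | pre a F =>
        intro G hU
        cases G with
        | pre b G => cases hU; exact ⟨G, .inl (.pre _ _), rfl⟩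
        | var o => cases o <;> cases hU
        | _ => cases hU
      | sum_left h ih =>
        intro G hU
        cases G with
        | sum G H =>
          cases hU
          obtain ⟨G', h | h, e⟩ := ih G rfl
          exacts [⟨G', .inl (.sum_left h), e⟩, ⟨G', .inr h, e⟩]
        | var o => cases o <;> cases hU
        | _ => cases hU
      | sum_right h ih =>
        intro G hU
        cases G with
        | sum G H =>
          cases hU
          obtain ⟨G', h | h, e⟩ := ih H rfl
          exacts [⟨G', .inl (.sum_right h), e⟩, ⟨G', .inr h, e⟩]
        | var o => cases o <;> cases hU
        | _ => cases hU
      | mu h ih =>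
        intro G hU
        cases G with
        | mu G =>
          cases hU
          obtain ⟨G', h | h, e⟩ := ih (G.inst (.mu G)) (bind_up_inst G (.mu G) _).symm
          exacts [⟨G', .inl (.mu h), e⟩, ⟨G', .inr h, e⟩]
        -- For `none` the derivation has re-entered `mu E`; its premise is a shorter derivation
        -- about the unfolding, to which the induction hypothesis applies with context `E`.
        | var o =>
          cases o <;> cases hU
          obtain ⟨G', h | h, e⟩ := ih E rfl <;> exact ⟨G', .inr h, e⟩
        | _ => cases hU
    intro h
    obtain ⟨G', h | h, e⟩ := key h (.var none) rfl
    exacts [(step_var h).elim, ⟨G', h, e⟩]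
  · rintro ⟨E', h, rfl⟩
    exact .mu (h.bind _)

theorem exposes_mu_iff {E : Term A (Option W)} {w : W} :
    Exposes (mu E) w ↔ Exposes E (some w) := by
  constructor
  · have key : ∀ {U : Term A W}, Exposes U w → ∀ G : Term A (Option W), G.inst (mu E) = U →
        Exposes G (some w) ∨ Exposes E (some w) := by
      intro U h
      induction h with
      | var w =>
        intro G hU
        cases G with
        | var o => cases o <;> cases hU; exact .inl (.var _)
        | _ => cases hU
      | sum_left h ih =>
        intro G hU
        cases G with
        | sum G H =>
          cases hU
          exact (ih G rfl).imp_left .sum_left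
        | var o => cases o <;> cases hU
        | _ => cases hU
      | sum_right h ih =>
        intro G hU
        cases G with
        | sum G H =>
          cases hU
          exact (ih H rfl).imp_left .sum_right
        | var o => cases o <;> cases hU
        | _ => cases hU
      | mu h ih =>
        intro G hU
        cases G with
        | mu G =>
          cases hU
          exact (ih (G.inst (.mu G)) (bind_up_inst G (.mu G) _).symm).imp_left .mu
        | var o =>
          cases o <;> cases hU
          exact .inr ((ih E rfl).elim id id)
        | _ => cases hU
    intro h
    exact (key h (.var none) rfl).elim (fun h => nomatch h) id
  · intro h
    exact .mu (h.bind (.var w))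

end Semantics

/-! ### Bisimilarity, up-to techniques and substitution into bisimilar contexts -/

section Bisimilarity

variable {A : Type v} {W W' : Type u}

/-- One silent step. -/
def Tau (E F : Term A W) : Prop := Step E .tau F

/-- The pairs in `R` satisfy the clauses of a divergence-preserving branching bisimulation, with
all pairs reached in `S`. -/
structure Progress (R S : Term A W → Term A W → Prop) : Prop where
  step : ∀ {E F}, R E F → ∀ {a E'}, Step E a E' →
    (a = .tau ∧ ∃ F', ReflTransGen Tau F F' ∧ S E F' ∧ S E' F') ∨
    (∃ F' F'', ReflTransGen Tau F F' ∧ Step F' a F'' ∧ S E F' ∧ S E' F'')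
  exposes : ∀ {E F}, R E F → ∀ {w}, Exposes E w →
    ∃ F', ReflTransGen Tau F F' ∧ S E F' ∧ Exposes F' w
  run : ∀ {E F}, R E F → ∀ r : ℕ → Term A W, r 0 = E → (∀ i, Tau (r i) (r (i + 1))) →
    ∃ j F', TransGen Tau F F' ∧ S (r j) F'

/-- Divergence-preserving branching bisimilarity. -/
def Bisimilar (E F : Term A W) : Prop :=
  ∃ R : Term A W → Term A W → Prop, (∀ E F, R E F → R F E) ∧ Progress R R ∧ R E F

theorem Progress.mono {R S S' : Term A W → Term A W → Prop} (h : Progress R S)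
    (hS : ∀ E F, S E F → S' E F) : Progress R S' where
  step hR _ _ hs := by
    rcases h.step hR hs with ⟨ha, F', h1, h2, h3⟩ | ⟨F', F'', h1, h2, h3, h4⟩
    exacts [.inl ⟨ha, F', h1, hS _ _ h2, hS _ _ h3⟩, .inr ⟨F', F'', h1, h2, hS _ _ h3, hS _ _ h4⟩]
  exposes hR _ hw := by
    obtain ⟨F', h1, h2, h3⟩ := h.exposes hR hw
    exact ⟨F', h1, hS _ _ h2, h3⟩
  run hR r h0 hr := by
    obtain ⟨j, F', h1, h2⟩ := h.run hR r h0 hr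
    exact ⟨j, F', h1, hS _ _ h2⟩

theorem Progress.anti {R R' S : Term A W → Term A W → Prop} (h : Progress R S)
    (hR : ∀ E F, R' E F → R E F) : Progress R' S where
  step h' := h.step (hR _ _ h')
  exposes h' := h.exposes (hR _ _ h')
  run h' := h.run (hR _ _ h')

theorem Progress.or {R R' S : Term A W → Term A W → Prop} (h : Progress R S)
    (h' : Progress R' S) : Progress (fun E F => R E F ∨ R' E F) S where
  step hR _ _ hs := hR.elim (fun hR => h.step hR hs) fun hR => h'.step hR hs
  exposes hR _ hw := hR.elim (fun hR => h.exposes hR hw) fun hR => h'.exposes hR hw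
  run hR r h0 hr := hR.elim (fun hR => h.run hR r h0 hr) fun hR => h'.run hR r h0 hr

theorem Bisimilar.symm {E F : Term A W} (h : Bisimilar E F) : Bisimilar F E := by
  obtain ⟨R, h1, h2, h3⟩ := h
  exact ⟨R, h1, h2, h1 _ _ h3⟩

theorem progress_bisimilar :
    Progress (Bisimilar : Term A W → Term A W → Prop) Bisimilar where
  step := by
    rintro E F ⟨R, h1, h2, h3⟩
    exact (h2.mono fun E F h => ⟨R, h1, h2, h⟩).step h3
  exposes := by
    rintro E F ⟨R, h1, h2, h3⟩
    exact (h2.mono fun E F h => ⟨R, h1, h2, h⟩).exposes h3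
  run := by
    rintro E F ⟨R, h1, h2, h3⟩
    exact (h2.mono fun E F h => ⟨R, h1, h2, h⟩).run h3

/-- A relation that progresses, in both directions, to its union with bisimilarity is contained
in bisimilarity. -/
theorem bisimilar_of_progress {R : Term A W → Term A W → Prop}
    (h : Progress R fun E F => R E F ∨ Bisimilar E F)
    (h' : Progress (flip R) fun E F => R F E ∨ Bisimilar E F) {E F : Term A W} (hR : R E F) :
    Bisimilar E F := by
  refine ⟨fun E F => (R E F ∨ R F E) ∨ Bisimilar E F, ?_, ?_, .inl (.inl hR)⟩
  · rintro E F ((h | h) | h)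
    exacts [.inl (.inr h), .inl (.inl h), .inr h.symm]
  · refine ((h.mono ?_).or (h'.mono ?_)).or (progress_bisimilar.mono ?_)
    · rintro E F (h | h)
      exacts [.inl (.inl h), .inr h]
    · rintro E F (h | h)
      exacts [.inl (.inr h), .inr h]
    · exact fun E F h => .inr h

/-- Every transition and every exposed variable of `E` is one of `F`, up to `S`. -/
structure StrongMatch (S : Term A W → Term A W → Prop) (E F : Term A W) : Prop where
  step : ∀ {a E'}, Step E a E' → ∃ F', Step F a F' ∧ S E' F'
  exposes : ∀ {w}, Exposes E w → Exposes F w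

theorem StrongMatch.mono {S S' : Term A W → Term A W → Prop} {E F : Term A W}
    (h : StrongMatch S E F) (hS : ∀ E F, S E F → S' E F) : StrongMatch S' E F where
  step hs := by
    obtain ⟨F', h1, h2⟩ := h.step hs
    exact ⟨F', h1, hS _ _ h2⟩
  exposes := h.exposes

theorem StrongMatch.trans_incl {S : Term A W → Term A W → Prop} {E F G : Term A W}
    (h : StrongMatch S E F) (h' : StrongMatch Eq F G) : StrongMatch S E G where
  step hs := by
    obtain ⟨F', h1, h2⟩ := h.step hs
    obtain ⟨G', h3, rfl⟩ := h'.step h1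
    exact ⟨_, h3, h2⟩
  exposes hw := h'.exposes (h.exposes hw)

theorem StrongMatch.incl_trans {S : Term A W → Term A W → Prop} {E F G : Term A W}
    (h' : StrongMatch Eq E F) (h : StrongMatch S F G) : StrongMatch S E G where
  step hs := by
    obtain ⟨F', h1, rfl⟩ := h'.step hs
    exact h.step h1
  exposes hw := h.exposes (h'.exposes hw)

/-- Pairs of `R` either match strongly, or lie in `A × B`, where all elements of `B` reach each
other silently and the transitions of the elements of `A` are inert or matched from within `B`. -/
theorem progress_of_collapse {R S : Term A W → Term A W → Prop} {C D : Set (Term A W)}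
    (hRS : ∀ E F, R E F → S E F)
    (hS : ∀ {u v}, u ∈ C → v ∈ D → S u v)
    (hD : ∀ {v v'}, v ∈ D → v' ∈ D → TransGen Tau v v')
    (hR : ∀ {u v}, R u v → (u ∈ C ∧ v ∈ D) ∨ StrongMatch S u v)
    (hstep : ∀ {u}, u ∈ C → ∀ {a u'}, Step u a u' →
      (a = .tau ∧ u' ∈ C) ∨ ∃ v ∈ D, ∃ v', Step v a v' ∧ S u' v')
    (hexp : ∀ {u}, u ∈ C → ∀ {w}, Exposes u w → ∃ v ∈ D, Exposes v w) : Progress R S where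
  step {u v} h a u' hs := by
    rcases hR h with ⟨hu, hv⟩ | hm
    · rcases hstep hu hs with ⟨ha, hu'⟩ | ⟨v', hv', v'', hs', hS'⟩
      · exact .inl ⟨ha, v, .refl, hS hu hv, hS hu' hv⟩
      · exact .inr ⟨v', v'', (hD hv hv').to_reflTransGen, hs', hS hu hv', hS'⟩
    · obtain ⟨v', h1, h2⟩ := hm.step hs
      exact .inr ⟨v, v', .refl, h1, hRS _ _ h, h2⟩
  exposes {u v} h w hw := by
    rcases hR h with ⟨hu, hv⟩ | hm
    · obtain ⟨v', hv', h'⟩ := hexp hu hw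
      exact ⟨v', (hD hv hv').to_reflTransGen, hS hu hv', h'⟩
    · exact ⟨v, .refl, hRS _ _ h, hm.exposes hw⟩
  run {u v} h r h0 hr := by
    rcases hR h with ⟨hu, hv⟩ | hm
    -- Since `v` lies on a silent cycle, it answers any divergence by returning to itself.
    · exact ⟨0, v, hD hv hv, h0 ▸ hS hu hv⟩
    · have := hr 0
      rw [h0] at this
      obtain ⟨v', h1, h2⟩ := hm.step this
      exact ⟨1, v', .single h1, h2⟩

theorem progress_of_strongMatch {R S : Term A W → Term A W → Prop}
    (hRS : ∀ E F, R E F → S E F) (hR : ∀ {u v}, R u v → StrongMatch S u v) : Progress R S :=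
  progress_of_collapse (C := ∅) (D := ∅) hRS (fun h => h.elim) (fun h => h.elim)
    (fun h => .inr (hR h)) (fun h => h.elim) (fun h => h.elim)

/-- Strong bisimulation up to union with bisimilarity. -/
theorem bisimilar_of_strongMatch {R : Term A W → Term A W → Prop}
    (h : ∀ {u v}, R u v → StrongMatch (fun E F => R E F ∨ Bisimilar E F) u v)
    (h' : ∀ {u v}, R u v → StrongMatch (fun E F => R F E ∨ Bisimilar E F) v u)
    {E F : Term A W} (hR : R E F) : Bisimilar E F :=
  bisimilar_of_progress (progress_of_strongMatch (fun _ _ => .inl) h)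
    (progress_of_strongMatch (fun _ _ => .inl) h') hR

theorem Bisimilar.refl (E : Term A W) : Bisimilar E E := by
  refine bisimilar_of_strongMatch (R := Eq) ?_ ?_ rfl
  · rintro u _ rfl
    exact ⟨fun h => ⟨_, h, .inl rfl⟩, id⟩
  · rintro u _ rfl
    exact ⟨fun h => ⟨_, h, .inl rfl⟩, id⟩

theorem Bisimilar.tauStar {E F E' : Term A W} (h : Bisimilar E F) (hE : ReflTransGen Tau E E') :
    ∃ F', ReflTransGen Tau F F' ∧ Bisimilar E' F' := by
  induction hE with
  | refl => exact ⟨F, .refl, h⟩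
  | tail _ hs ih =>
    obtain ⟨F', h1, h2⟩ := ih
    rcases progress_bisimilar.step h2 hs with ⟨_, F'', h3, _, h4⟩ | ⟨F'', F''', h3, h4, _, h5⟩
    · exact ⟨F'', h1.trans h3, h4⟩
    · exact ⟨F''', (h1.trans h3).tail h4, h5⟩

/-- If every element of `N` has a silent step into `N`, then every process bisimilar to an element
of `N` has nonempty silent runs to processes bisimilar to elements of `N`. -/
theorem Bisimilar.exists_tauPlus {N : Term A W → Prop} (hN : ∀ u, N u → ∃ u', Tau u u' ∧ N u')
    {F G : Term A W} (hF : N F) (h : Bisimilar F G) :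
    ∃ u G', N u ∧ TransGen Tau G G' ∧ Bisimilar u G' := by
  choose! f hf using hN
  have hn : ∀ i, N (f^[i] F) := by
    intro i
    induction i with
    | zero => exact hF
    | succ i ih =>
      rw [Function.iterate_succ_apply']
      exact (hf _ ih).2
  obtain ⟨j, G', h1, h2⟩ := progress_bisimilar.run h (fun i => f^[i] F) rfl fun i => by
    rw [Function.iterate_succ_apply']
    exact (hf _ (hn i)).1
  exact ⟨_, G', hn j, h1, h2⟩

/-- As `Bisimilar.exists_tauPlus`, with nonempty silent runs inside `N`. -/
theorem exists_tauPlus_of_weak {N : Term A W → Prop}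
    (hN : ∀ u, N u → ∃ u', TransGen Tau u u' ∧ N u') {F G : Term A W} (hF : N F)
    (h : Bisimilar F G) : ∃ u G', N u ∧ TransGen Tau G G' ∧ Bisimilar u G' := by
  obtain ⟨u, G', ⟨x, hx, hux⟩, h1, h2⟩ :=
    -- Closing `N` under silent predecessors turns nonempty paths into single steps; `tauStar`
    -- afterwards leads back into `N`.
    Bisimilar.exists_tauPlus (N := fun u => ∃ x, N x ∧ ReflTransGen Tau u x) (by
      rintro u ⟨x, hx, hux⟩
      obtain ⟨y, hxy, hy⟩ := hN x hx
      obtain ⟨z, huz, hzy⟩ := TransGen.head'_iff.1 (TransGen.trans_right hux hxy)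
      exact ⟨z, huz, y, hy, hzy⟩) ⟨F, hF, .refl⟩ h
  obtain ⟨G'', h3, h4⟩ := h2.tauStar hux
  exact ⟨x, G'', hx, h1.trans_left h3, h4⟩

/-- The composite relation is itself a bisimulation. Its step clause goes through because an inert
move may be absorbed after any number of silent steps, with both its source and its target related
to the endpoint. -/
theorem Bisimilar.trans {E F G : Term A W} (h : Bisimilar E F) (h' : Bisimilar F G) :
    Bisimilar E G := by
  refine ⟨fun E G => ∃ F, Bisimilar E F ∧ Bisimilar F G, ?_, ?_, F, h, h'⟩
  · rintro E G ⟨F, h, h'⟩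
    exact ⟨F, h'.symm, h.symm⟩
  refine ⟨?_, ?_, ?_⟩
  · rintro E G ⟨F, h, h'⟩ a E' hs
    rcases progress_bisimilar.step h hs with ⟨rfl, F', h1, h2, h3⟩ | ⟨F', F'', h1, h2, h3, h4⟩
    · obtain ⟨G', h4, h5⟩ := h'.tauStar h1
      exact .inl ⟨rfl, G', h4, ⟨F', h2, h5⟩, F', h3, h5⟩
    · obtain ⟨G', h5, h6⟩ := h'.tauStar h1
      rcases progress_bisimilar.step h6 h2 with
        ⟨rfl, G'', h7, h8, h9⟩ | ⟨G'', G''', h7, h8, h9, h10⟩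
      · exact .inl ⟨rfl, G'', h5.trans h7, ⟨F', h3, h8⟩, F'', h4, h9⟩
      · exact .inr ⟨G'', G''', h5.trans h7, h8, ⟨F', h3, h9⟩, F'', h4, h10⟩
  · rintro E G ⟨F, h, h'⟩ w hw
    obtain ⟨F', h1, h2, h3⟩ := progress_bisimilar.exposes h hw
    obtain ⟨G', h4, h5⟩ := h'.tauStar h1
    obtain ⟨G'', h6, h7, h8⟩ := progress_bisimilar.exposes h5 h3
    exact ⟨G'', h4.trans h6, ⟨F', h2, h7⟩, h8⟩
  · rintro E G ⟨F, h, h'⟩ r h0 hr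
    obtain ⟨u, G', ⟨j, hj⟩, h1, h2⟩ :=
      -- The run clause supplies just one answer in the middle process. Applied to the tails of `r`,
      -- it gives each process bisimilar to some `r j` a nonempty silent path to another such
      -- process, hence a divergence that the third process must answer.
      exists_tauPlus_of_weak (N := fun u => ∃ j, Bisimilar (r j) u) (by
        rintro u ⟨j, hj⟩
        obtain ⟨k, u', h1, h2⟩ := progress_bisimilar.run hj (fun i => r (j + i)) rfl
          fun i => hr (j + i)
        exact ⟨u', h1, j + k, h2⟩) ⟨0, h0.symm ▸ h⟩ h'
    exact ⟨j, G', h1, u, hj, h2⟩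

/-- Rooted divergence-preserving branching bisimilarity. -/
structure Cong (E F : Term A W) : Prop where
  left : StrongMatch Bisimilar E F
  right : StrongMatch Bisimilar F E

namespace Cong

theorem refl (E : Term A W) : Cong E E :=
  ⟨⟨fun h => ⟨_, h, .refl _⟩, id⟩, ⟨fun h => ⟨_, h, .refl _⟩, id⟩⟩

theorem symm {E F : Term A W} (h : Cong E F) : Cong F E := ⟨h.right, h.left⟩

theorem trans {E F G : Term A W} (h : Cong E F) (h' : Cong F G) : Cong E G := by
  constructor
  · refine ⟨fun hs => ?_, fun hw => h'.left.exposes (h.left.exposes hw)⟩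
    obtain ⟨F', h1, h2⟩ := h.left.step hs
    obtain ⟨G', h3, h4⟩ := h'.left.step h1
    exact ⟨G', h3, h2.trans h4⟩
  · refine ⟨fun hs => ?_, fun hw => h.right.exposes (h'.right.exposes hw)⟩
    obtain ⟨F', h1, h2⟩ := h'.right.step hs
    obtain ⟨G', h3, h4⟩ := h.right.step h1
    exact ⟨G', h3, h2.trans h4⟩

theorem bisimilar {E F : Term A W} (h : Cong E F) : Bisimilar E F := by
  refine bisimilar_of_strongMatch (R := fun u v => u = E ∧ v = F) ?_ ?_ ⟨rfl, rfl⟩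
  · rintro _ _ ⟨rfl, rfl⟩
    exact h.left.mono fun _ _ => .inr
  · rintro _ _ ⟨rfl, rfl⟩
    exact h.right.mono fun _ _ => .inr

theorem of_iff {E F : Term A W} (h : ∀ a K, Step E a K ↔ Step F a K)
    (h' : ∀ w, Exposes E w ↔ Exposes F w) : Cong E F :=
  ⟨⟨fun hs => ⟨_, (h _ _).1 hs, .refl _⟩, fun hw => (h' _).1 hw⟩,
    ⟨fun hs => ⟨_, (h _ _).2 hs, .refl _⟩, fun hw => (h' _).2 hw⟩⟩

theorem pre (a : Act A) {E F : Term A W} (h : Bisimilar E F) : Cong (pre a E) (pre a F) := by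
  constructor
  · refine ⟨fun hs => ?_, fun hw => (exposes_pre hw).elim⟩
    obtain ⟨rfl, rfl⟩ := step_pre_iff.1 hs
    exact ⟨F, .pre _ _, h⟩
  · refine ⟨fun hs => ?_, fun hw => (exposes_pre hw).elim⟩
    obtain ⟨rfl, rfl⟩ := step_pre_iff.1 hs
    exact ⟨E, .pre _ _, h.symm⟩

theorem sum {E E' F F' : Term A W} (h : Cong E E') (h' : Cong F F') :
    Cong (sum E F) (sum E' F') := by
  have key : ∀ {E E' F F' : Term A W}, StrongMatch Bisimilar E E' → StrongMatch Bisimilar F F' →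
      StrongMatch Bisimilar (.sum E F) (.sum E' F') := by
    intro E E' F F' h h'
    constructor
    · intro a K hs
      rcases step_sum_iff.1 hs with hs | hs
      · obtain ⟨K', h1, h2⟩ := h.step hs
        exact ⟨K', .sum_left h1, h2⟩
      · obtain ⟨K', h1, h2⟩ := h'.step hs
        exact ⟨K', .sum_right h1, h2⟩
    · exact fun hw => exposes_sum_iff.2 ((exposes_sum_iff.1 hw).imp h.exposes h'.exposes)
  exact ⟨key h.left h'.left, key h.right h'.right⟩

end Cong

/-- Instances, under the substitutions `σ` and `θ`, of bisimilar expressions; or bisimilar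
expressions. -/
def SubstRel (σ θ : W → Term A W') (K L : Term A W') : Prop :=
  (∃ G H, Bisimilar G H ∧ K = G.bind σ ∧ L = H.bind θ) ∨ Bisimilar K L

/-- A move of `G.bind σ` made by `G` is answered by `H` through bisimilarity; one made by an exposed
variable is answered after `H` has silently reached an expression exposing the same variable. The
hypothesis on `σ` and `θ` may refer back to instances, which is what recursion requires. -/
theorem progress_substRel {σ θ : W → Term A W'}
    (h : ∀ w, StrongMatch (SubstRel σ θ) (σ w) (θ w)) :
    Progress (fun K L => ∃ G H, Bisimilar G H ∧ K = G.bind σ ∧ L = H.bind θ)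
      (SubstRel σ θ) := by
  have lift : ∀ {H H' : Term A W}, ReflTransGen Tau H H' →
      ReflTransGen Tau (H.bind θ) (H'.bind θ) := fun h =>
    h.lift (fun H => H.bind θ) fun _ _ hs => hs.bind θ
  have var_step : ∀ {G H : Term A W}, Bisimilar G H → ∀ {w}, Exposes G w →
      ∀ {a K}, Step (σ w) a K → ∃ H' L, ReflTransGen Tau (H.bind θ) (H'.bind θ) ∧
        Step (H'.bind θ) a L ∧ Bisimilar G H' ∧ SubstRel σ θ K L := by
    intro G H hGH w hw a K hK
    obtain ⟨H', h1, h2, h3⟩ := progress_bisimilar.exposes hGH hw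
    obtain ⟨L, h4, h5⟩ := (h w).step hK
    exact ⟨H', L, lift h1, h3.bind_step h4, h2, h5⟩
  refine ⟨?_, ?_, ?_⟩
  · rintro _ _ ⟨G, H, hGH, rfl, rfl⟩ a K hs
    rcases step_bind_iff.1 hs with ⟨G', hs', rfl⟩ | ⟨w, hw, hs⟩
    · rcases progress_bisimilar.step hGH hs' with ⟨rfl, H', h1, h2, h3⟩ | ⟨H', H'', h1, h2, h3, h4⟩
      · exact .inl ⟨rfl, _, lift h1, .inl ⟨_, _, h2, rfl, rfl⟩, .inl ⟨_, _, h3, rfl, rfl⟩⟩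
      · exact .inr ⟨_, _, lift h1, h2.bind θ, .inl ⟨_, _, h3, rfl, rfl⟩,
          .inl ⟨_, _, h4, rfl, rfl⟩⟩
    · obtain ⟨H', L, h1, h2, h3, h4⟩ := var_step hGH hw hs
      exact .inr ⟨_, L, h1, h2, .inl ⟨_, _, h3, rfl, rfl⟩, h4⟩
  · rintro _ _ ⟨G, H, hGH, rfl, rfl⟩ y hy
    obtain ⟨w, hw, hy⟩ := exposes_bind_iff.1 hy
    obtain ⟨H', h1, h2, h3⟩ := progress_bisimilar.exposes hGH hw
    exact ⟨_, lift h1, .inl ⟨_, _, h2, rfl, rfl⟩, h3.bind ((h w).exposes hy)⟩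
  · rintro _ _ ⟨G, H, hGH, rfl, rfl⟩ r h0 hr
    -- Either the run at some point uses a transition of a substituted process, which is answered by
    -- a genuine step, or it stays within the context forever and is a run of `G`.
    by_cases hex : ∃ i G', r i = G'.bind σ ∧ ReflTransGen Tau G G' ∧
        ∃ w, Exposes G' w ∧ Tau (σ w) (r (i + 1))
    · obtain ⟨i, G', _, hGG', w, hw, hs⟩ := hex
      obtain ⟨H', h1, h2⟩ := hGH.tauStar hGG'
      obtain ⟨H'', L, h3, h4, _, h5⟩ := var_step h2 hw hs
      exact ⟨i + 1, L, TransGen.tail' ((lift h1).trans h3) h4, h5⟩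
    · have hn : ∀ i, ∀ G', ReflTransGen Tau G G' → r i = G'.bind σ →
          ∃ G'', Tau G' G'' ∧ r (i + 1) = G''.bind σ := by
        intro i G' hGG' hi
        have hs := hr i
        rw [hi] at hs
        rcases step_bind_iff.1 hs with ⟨G'', hs, e⟩ | ⟨w, hw, hs⟩
        exacts [⟨G'', hs, e⟩, (hex ⟨i, G', hi, hGG', w, hw, hs⟩).elim]
      choose! f hf using hn
      let s : ℕ → Term A W := fun i => Nat.rec G (fun i G' => f i G') i
      have hs : ∀ i, ReflTransGen Tau G (s i) ∧ r i = (s i).bind σ := by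
        intro i
        induction i with
        | zero => exact ⟨.refl, h0⟩
        | succ i ih => exact ⟨ih.1.tail (hf i _ ih.1 ih.2).1, (hf i _ ih.1 ih.2).2⟩
      obtain ⟨j, H', h1, h2⟩ := progress_bisimilar.run hGH s rfl fun i =>
        (hf i _ (hs i).1 (hs i).2).1
      exact ⟨j, _, h1.lift (fun H => H.bind θ) fun _ _ hs => hs.bind θ,
        .inl ⟨_, _, h2, (hs j).2, rfl⟩⟩

theorem SubstRel.bisimilar {σ θ : W → Term A W'}
    (h : ∀ w, StrongMatch (SubstRel σ θ) (σ w) (θ w))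
    (h' : ∀ w, StrongMatch (SubstRel θ σ) (θ w) (σ w)) {K L : Term A W'}
    (hKL : SubstRel σ θ K L) : Bisimilar K L := by
  rcases hKL with hKL | hKL
  · refine bisimilar_of_progress (progress_substRel h) ?_ hKL
    refine ((progress_substRel h').mono ?_).anti ?_
    · rintro _ _ (⟨G, H, hGH, rfl, rfl⟩ | h)
      exacts [.inl ⟨H, G, hGH.symm, rfl, rfl⟩, .inr h]
    · rintro _ _ ⟨G, H, hGH, rfl, rfl⟩
      exact ⟨H, G, hGH.symm, rfl, rfl⟩
  · exact hKL

end Bisimilarity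

/-! ### Congruence, the basic axioms and nested recursions -/

section Congruence

variable {A : Type v} {W W' : Type u}

theorem step_rename_iff {E : Term A W} {f : W → W'} {a : Act A} {K : Term A W'} :
    Step (E.rename f) a K ↔ ∃ E', Step E a E' ∧ K = E'.rename f := by
  rw [rename_eq_bind, step_bind_iff]
  simp only [rename_eq_bind]
  exact ⟨fun h => h.resolve_right fun ⟨_, _, h⟩ => step_var h, .inl⟩

theorem exposes_rename_iff {E : Term A W} {f : W → W'} {y : W'} :
    Exposes (E.rename f) y ↔ ∃ w, Exposes E w ∧ y = f w := by
  rw [rename_eq_bind, exposes_bind_iff]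
  simp only [Function.comp, exposes_var_iff]

namespace Cong

theorem bind {σ θ : W → Term A W'} (h : ∀ w, Cong (σ w) (θ w)) {G H : Term A W}
    (hGH : Cong G H) : Cong (G.bind σ) (H.bind θ) := by
  have key : ∀ {σ θ : W → Term A W'} {G H : Term A W}, (∀ w, Cong (σ w) (θ w)) →
      StrongMatch Bisimilar G H → StrongMatch Bisimilar (G.bind σ) (H.bind θ) := by
    intro σ θ G H h hGH
    have hb : ∀ {K L}, SubstRel σ θ K L → Bisimilar K L :=
      SubstRel.bisimilar (fun w => (h w).left.mono fun _ _ => .inr)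
        fun w => (h w).right.mono fun _ _ => .inr
    constructor
    · intro a K hs
      rcases step_bind_iff.1 hs with ⟨G', hs', rfl⟩ | ⟨w, hw, hs⟩
      · obtain ⟨H', h1, h2⟩ := hGH.step hs'
        exact ⟨_, h1.bind θ, hb (.inl ⟨_, _, h2, rfl, rfl⟩)⟩
      · obtain ⟨L, h1, h2⟩ := (h w).left.step hs
        exact ⟨L, (hGH.exposes hw).bind_step h1, h2⟩
    · intro y hy
      obtain ⟨w, hw, hy⟩ := exposes_bind_iff.1 hy
      exact (hGH.exposes hw).bind ((h w).left.exposes hy)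
  exact ⟨key h hGH.left, key (fun w => (h w).symm) hGH.right⟩

theorem inst {E F : Term A (Option W)} (h : Cong E F) {P Q : Term A W} (hPQ : Cong P Q) :
    Cong (E.inst P) (F.inst Q) :=
  bind (fun o => by cases o; exacts [hPQ, refl _]) h

/-- Congruence of recursion. The unguarded occurrences of the recursion variable do not matter. -/
theorem mu_of_match {E F : Term A (Option W)}
    (h : ∀ {a E'}, Step E a E' → ∃ F', Step F a F' ∧ Bisimilar E' F')
    (h' : ∀ {a F'}, Step F a F' → ∃ E', Step E a E' ∧ Bisimilar F' E')
    (hexp : ∀ w, Exposes E (some w) ↔ Exposes F (some w)) : Cong (mu E) (mu F) := by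
  have key : ∀ {E F : Term A (Option W)},
      (∀ {a E'}, Step E a E' → ∃ F', Step F a F' ∧ Bisimilar E' F') →
      (∀ w, Exposes E (some w) ↔ Exposes F (some w)) →
      ∀ o, StrongMatch (SubstRel (single (.mu E)) (single (.mu F))) (single (.mu E) o)
        (single (.mu F) o) := by
    rintro E F h hexp (_ | w)
    · constructor
      · intro a K hs
        -- Only transitions of the body occur here, so exposure of `none` need not agree on the two
        -- sides.
        obtain ⟨E', hs', rfl⟩ := step_mu_iff.1 hs
        obtain ⟨F', h1, h2⟩ := h hs'
        exact ⟨_, step_mu_iff.2 ⟨F', h1, rfl⟩, .inl ⟨E', F', h2, rfl, rfl⟩⟩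
      · exact fun hw => exposes_mu_iff.2 ((hexp _).1 (exposes_mu_iff.1 hw))
    · exact ⟨fun hs => (step_var hs).elim, id⟩
  have hl := key h hexp
  have hr := key h' fun w => (hexp w).symm
  exact ⟨(hl none).mono fun _ _ => SubstRel.bisimilar hl hr,
    (hr none).mono fun _ _ => SubstRel.bisimilar hr hl⟩

theorem mu {E F : Term A (Option W)} (h : Cong E F) : Cong (mu E) (mu F) :=
  mu_of_match h.left.step h.right.step fun _ => ⟨h.left.exposes, h.right.exposes⟩

theorem mu_unfold (E : Term A (Option W)) : Cong (.mu E) (E.inst (.mu E)) :=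
  of_iff (fun _ _ => step_mu_unfold_iff) fun _ => exposes_mu_unfold_iff

theorem sum_comm (E F : Term A W) : Cong (.sum E F) (.sum F E) :=
  of_iff (fun _ _ => by simp only [step_sum_iff]; tauto)
    fun _ => by simp only [exposes_sum_iff]; tauto

theorem sum_assoc (E F G : Term A W) : Cong (.sum E (.sum F G)) (.sum (.sum E F) G) :=
  of_iff (fun _ _ => by simp only [step_sum_iff]; tauto)
    fun _ => by simp only [exposes_sum_iff]; tauto

theorem sum_idem (E : Term A W) : Cong (.sum E E) E :=
  of_iff (fun _ _ => by simp only [step_sum_iff]; tauto)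
    fun _ => by simp only [exposes_sum_iff]; tauto

theorem sum_nil (E : Term A W) : Cong (.sum E nil) E :=
  of_iff (fun _ _ => by simp only [step_sum_iff, step_nil, or_false])
    fun _ => by simp only [exposes_sum_iff, exposes_nil, or_false]

/-- The branching law. -/
theorem branching (a : Act A) (E F : Term A W) :
    Cong (.pre a (.sum (.pre .tau (.sum E F)) F)) (.pre a (.sum E F)) := by
  refine pre a ?_
  let l : Term A W := .sum (.pre .tau (.sum E F)) F
  let r : Term A W := .sum E F
  have hr : ReflTransGen Tau l r := .single (.sum_left (.pre _ _))
  refine bisimilar_of_progress (R := fun u v => u = l ∧ v = r) ⟨?_, ?_, ?_⟩ ⟨?_, ?_, ?_⟩ ⟨rfl, rfl⟩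
  · rintro _ _ ⟨rfl, rfl⟩ b K hs
    rcases step_sum_iff.1 hs with hs | hs
    · obtain ⟨rfl, rfl⟩ := step_pre_iff.1 hs
      exact .inl ⟨rfl, r, .refl, .inl ⟨rfl, rfl⟩, .inr (.refl _)⟩
    · exact .inr ⟨r, K, .refl, .sum_right hs, .inl ⟨rfl, rfl⟩, .inr (.refl _)⟩
  · rintro _ _ ⟨rfl, rfl⟩ w hw
    refine ⟨r, .refl, .inl ⟨rfl, rfl⟩, .sum_right ?_⟩
    exact (exposes_sum_iff.1 hw).resolve_left exposes_pre
  · rintro _ _ ⟨rfl, rfl⟩ s h0 hs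
    have h1 : Tau l (s 1) := h0 ▸ hs 0
    rcases step_sum_iff.1 h1 with h1 | h1
    · have h1 := (step_pre_iff.1 h1).2
      have h2 := hs 1
      rw [h1] at h2
      -- The first step of the run, from `l` to `r`, is inert; the second is a step of `r` and
      -- supplies the nonempty answer.
      exact ⟨2, s 2, .single h2, .inr (.refl _)⟩
    · exact ⟨1, s 1, .single (.sum_right h1), .inr (.refl _)⟩
  · rintro _ _ ⟨rfl, rfl⟩ b K hs
    exact .inr ⟨r, K, hr, hs, .inr (.refl _), .inr (.refl _)⟩
  · rintro _ _ ⟨rfl, rfl⟩ w hw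
    exact ⟨r, hr, .inr (.refl _), hw⟩
  · rintro _ _ ⟨rfl, rfl⟩ s h0 hs
    exact ⟨0, r, .single (.sum_left (.pre _ _)), .inr (h0 ▸ .refl _)⟩

theorem mu_sum_var (E : Term A (Option W)) : Cong (.mu (.sum (var none) E)) (.mu E) := by
  refine mu_of_match (fun hs => ?_) (fun hs => ⟨_, .sum_right hs, .refl _⟩) fun w => ?_
  · exact ⟨_, (step_sum_iff.1 hs).resolve_left step_var, .refl _⟩
  · rw [exposes_sum_iff, exposes_var_iff]
    simp

end Cong

/-- The substitution of `Q` for the variable `none` and of `P` for the variable `some none`. -/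
def double (Q P : Term A W) (o : Option (Option W)) : Term A W := o.elim Q (single P)

theorem inst_inst (E : Term A (Option (Option W))) (Q : Term A (Option W)) (P : Term A W) :
    (E.inst Q).inst P = E.bind (double (Q.inst P) P) := inst_bind E Q (single P)

section NestedRecursion

variable (M : Term A (Option (Option W)))

theorem step_mu_mu_iff {a : Act A} {K : Term A W} : Step (mu (mu M)) a K ↔
    ∃ M', Step M a M' ∧ K = M'.bind (double ((mu M).inst (mu (mu M))) (mu (mu M))) := by
  simp only [step_mu_iff, ← inst_inst]
  constructor
  · rintro ⟨_, ⟨M', h, rfl⟩, rfl⟩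
    exact ⟨M', h, rfl⟩
  · rintro ⟨M', h, rfl⟩
    exact ⟨_, ⟨M', h, rfl⟩, rfl⟩

/-- If `mu M` exposes the outer variable, the instance also has the transitions of `mu (mu M)`; but
these are what the transitions of `mu M` itself already provide. -/
theorem step_mu_inst_mu_mu_iff {a : Act A} {K : Term A W} :
    Step ((mu M).inst (mu (mu M))) a K ↔ Step (mu (mu M)) a K := by
  rw [step_inst_iff, ← step_mu_iff (E := mu M)]
  tauto

theorem exposes_mu_inst_mu_mu_iff {w : W} :
    Exposes ((mu M).inst (mu (mu M))) w ↔ Exposes (mu (mu M)) w := by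
  rw [exposes_inst_iff, exposes_mu_iff (E := mu M)]
  tauto

theorem step_mu_join_iff {a : Act A} {K : Term A W} : Step (mu (M.rename Option.join)) a K ↔
    ∃ M', Step M a M' ∧ K = M'.bind (single (mu (M.rename Option.join)) ∘ Option.join) := by
  simp only [step_mu_iff, step_rename_iff, ← bind_rename]
  constructor
  · rintro ⟨_, ⟨M', h, rfl⟩, rfl⟩
    exact ⟨M', h, rfl⟩
  · rintro ⟨M', h, rfl⟩
    exact ⟨_, ⟨M', h, rfl⟩, rfl⟩

theorem exposes_mu_join_iff {w : W} :
    Exposes (mu (M.rename Option.join)) w ↔ Exposes M (some (some w)) := by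
  rw [exposes_mu_iff, exposes_rename_iff]
  constructor
  · rintro ⟨_ | _ | y, h, e⟩
    · cases e
    · cases e
    · cases e
      exact h
  · exact fun h => ⟨_, h, rfl⟩

/-- Two nested recursions can be contracted to one. -/
theorem Cong.mu_mu : Cong (.mu (.mu M)) (.mu (M.rename Option.join)) := by
  set σ := double ((Term.mu M).inst (.mu (.mu M))) (.mu (.mu M)) with hσ
  set θ := single (.mu (M.rename Option.join)) ∘ Option.join with hθ
  have hl : StrongMatch (SubstRel σ θ) (.mu (.mu M)) (.mu (M.rename Option.join)) := by
    constructor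
    · intro a K hs
      obtain ⟨M', h, rfl⟩ := (step_mu_mu_iff M).1 hs
      exact ⟨_, (step_mu_join_iff M).2 ⟨M', h, rfl⟩, .inl ⟨M', M', .refl _, rfl, rfl⟩⟩
    · intro w hw
      rw [exposes_mu_join_iff]
      exact exposes_mu_iff.1 (exposes_mu_iff.1 hw)
  have hr : StrongMatch (SubstRel θ σ) (.mu (M.rename Option.join)) (.mu (.mu M)) := by
    constructor
    · intro a K hs
      obtain ⟨M', h, rfl⟩ := (step_mu_join_iff M).1 hs
      exact ⟨_, (step_mu_mu_iff M).2 ⟨M', h, rfl⟩, .inl ⟨M', M', .refl _, rfl, rfl⟩⟩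
    · intro w hw
      rw [exposes_mu_join_iff] at hw
      exact exposes_mu_iff.2 (exposes_mu_iff.2 hw)
  have hl' : ∀ o, StrongMatch (SubstRel σ θ) (σ o) (θ o) := by
    rintro (_ | _ | w)
    · exact StrongMatch.incl_trans ⟨fun hs => ⟨_, (step_mu_inst_mu_mu_iff M).1 hs, rfl⟩,
        (exposes_mu_inst_mu_mu_iff M).1⟩ hl
    · exact hl
    · exact ⟨fun hs => (step_var hs).elim, id⟩
  have hr' : ∀ o, StrongMatch (SubstRel θ σ) (θ o) (σ o) := by
    rintro (_ | _ | w)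
    · exact hr.trans_incl ⟨fun hs => ⟨_, (step_mu_inst_mu_mu_iff M).2 hs, rfl⟩,
        (exposes_mu_inst_mu_mu_iff M).2⟩
    · exact hr
    · exact ⟨fun hs => (step_var hs).elim, id⟩
  exact ⟨hl.mono fun _ _ => SubstRel.bisimilar hl' hr', hr.mono fun _ _ =>
    SubstRel.bisimilar hr' hl'⟩

end NestedRecursion

/-- Contraction identifies the two recursion variables, so both sides contract to the same term. -/
theorem Cong.mu_mu_sum_var (E F : Term A (Option (Option W))) :
    Cong (.mu (.mu (.sum (.pre .tau (.sum (var (some none)) E)) F)))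
      (.mu (.mu (.sum (.pre .tau (.sum (var none) E)) F))) :=
  (mu_mu (.sum (.pre .tau (.sum (var (some none)) E)) F)).trans
    (mu_mu (.sum (.pre .tau (.sum (var none) E)) F)).symm

/-- The right side contracts to `D`, with a single silent loop. On the left, `P` and `M.inst P` both
behave like `D`: the silent moves from `P` to itself and to `M.inst P`, and the loop at `M.inst P`,
all correspond to the loop at `D`. -/
theorem Cong.mu_tau_loop (E : Term A (Option (Option W))) :
    Cong (.mu (.sum (.pre .tau (var none)) (.mu (.sum (.pre .tau (var none)) E))))
      (.mu (.mu (.sum (.pre .tau (var none)) E))) := by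
  refine Cong.trans ?_ (Cong.mu_mu _).symm
  let M : Term A (Option W) := .mu (.sum (.pre .tau (var none)) E)
  let P : Term A W := .mu (.sum (.pre .tau (var none)) M)
  let D : Term A W := .mu (.sum (.pre .tau (var none)) (E.rename Option.join))
  let σ := double (M.inst P) P
  let θ := single D ∘ Option.join
  have hP : ∀ {a K}, Step P a K ↔ (a = .tau ∧ (K = P ∨ K = M.inst P)) ∨
      ∃ E', Step E a E' ∧ K = E'.bind σ := by
    intro a K
    simp only [P, step_mu_iff, step_sum_iff, step_pre_iff, M]
    constructor
    · rintro ⟨K', ⟨rfl, rfl⟩ | ⟨E', ⟨rfl, rfl⟩ | h, rfl⟩, rfl⟩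
      · exact .inl ⟨rfl, .inl rfl⟩
      · exact .inl ⟨rfl, .inr rfl⟩
      · exact .inr ⟨E', h, inst_inst _ _ _⟩
    · rintro (⟨rfl, rfl | rfl⟩ | ⟨E', h, rfl⟩)
      · exact ⟨_, .inl ⟨rfl, rfl⟩, rfl⟩
      · exact ⟨_, .inr ⟨_, .inl ⟨rfl, rfl⟩, rfl⟩, rfl⟩
      · exact ⟨_, .inr ⟨_, .inr h, rfl⟩, (inst_inst _ _ _).symm⟩
  have hM : ∀ {a K}, Step (M.inst P) a K ↔ (a = .tau ∧ K = M.inst P) ∨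
      (∃ E', Step E a E' ∧ K = E'.bind σ) ∨ Exposes E (some none) ∧ Step P a K := by
    intro a K
    simp only [step_inst_iff, M, step_mu_iff, exposes_mu_iff, exposes_sum_iff, exposes_pre,
      step_sum_iff, step_pre_iff, false_or]
    rw [← or_assoc]
    refine or_congr_left ⟨?_, ?_⟩
    · rintro ⟨_, ⟨E', ⟨rfl, rfl⟩ | h, rfl⟩, rfl⟩
      · exact .inl ⟨rfl, rfl⟩
      · exact .inr ⟨E', h, inst_inst _ _ _⟩
    · rintro (⟨rfl, rfl⟩ | ⟨E', h, rfl⟩)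
      · exact ⟨_, ⟨_, .inl ⟨rfl, rfl⟩, rfl⟩, rfl⟩
      · exact ⟨_, ⟨_, .inr h, rfl⟩, (inst_inst _ _ _).symm⟩
  have hD : ∀ {a K}, Step D a K ↔ (a = .tau ∧ K = D) ∨ ∃ E', Step E a E' ∧ K = E'.bind θ := by
    intro a K
    refine (step_mu_join_iff (.sum (.pre .tau (var none)) E)).trans ?_
    simp only [step_sum_iff, step_pre_iff]
    constructor
    · rintro ⟨E', ⟨rfl, rfl⟩ | h, rfl⟩
      exacts [.inl ⟨rfl, rfl⟩, .inr ⟨E', h, rfl⟩]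
    · rintro (⟨rfl, rfl⟩ | ⟨E', h, rfl⟩)
      exacts [⟨_, .inl ⟨rfl, rfl⟩, rfl⟩, ⟨E', .inr h, rfl⟩]
  have eP : ∀ {w}, Exposes P w ↔ Exposes E (some (some w)) := by
    intro w
    simp only [P, M, exposes_mu_iff, exposes_sum_iff, exposes_pre, false_or]
  have eM : ∀ {w}, Exposes (M.inst P) w ↔ Exposes E (some (some w)) := by
    intro w
    rw [exposes_inst_iff, eP]
    simp only [M, exposes_mu_iff, exposes_sum_iff, exposes_pre, false_or]
    tauto
  have eD : ∀ {w}, Exposes D w ↔ Exposes E (some (some w)) := by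
    intro w
    refine (exposes_mu_join_iff (.sum (.pre .tau (var none)) E)).trans ?_
    simp only [exposes_sum_iff, exposes_pre, false_or]
  have inl : ∀ {σ θ : Option (Option W) → Term A W}
      (G : Term A (Option (Option W))), SubstRel σ θ (G.bind σ) (G.bind θ) :=
    fun G => .inl ⟨G, G, .refl _, rfl, rfl⟩
  have hl : StrongMatch (SubstRel σ θ) P D := by
    refine ⟨fun hs => ?_, fun hw => eD.2 (eP.1 hw)⟩
    rcases hP.1 hs with ⟨rfl, rfl | rfl⟩ | ⟨E', h, rfl⟩
    · exact ⟨D, hD.2 (.inl ⟨rfl, rfl⟩), inl (var (some none))⟩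
    · exact ⟨D, hD.2 (.inl ⟨rfl, rfl⟩), inl (var none)⟩
    · exact ⟨_, hD.2 (.inr ⟨E', h, rfl⟩), inl E'⟩
  have hr : StrongMatch (SubstRel θ σ) D P := by
    refine ⟨fun hs => ?_, fun hw => eP.2 (eD.1 hw)⟩
    rcases hD.1 hs with ⟨rfl, rfl⟩ | ⟨E', h, rfl⟩
    · exact ⟨P, hP.2 (.inl ⟨rfl, .inl rfl⟩), inl (var (some none))⟩
    · exact ⟨_, hP.2 (.inr ⟨E', h, rfl⟩), inl E'⟩
  have hl' : ∀ o, StrongMatch (SubstRel σ θ) (σ o) (θ o) := by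
    rintro (_ | _ | w)
    · refine ⟨fun hs => ?_, fun hw => eD.2 (eM.1 hw)⟩
      rcases hM.1 hs with ⟨rfl, rfl⟩ | ⟨E', h, rfl⟩ | ⟨_, hs⟩
      · exact ⟨D, hD.2 (.inl ⟨rfl, rfl⟩), inl (var none)⟩
      · exact ⟨_, hD.2 (.inr ⟨E', h, rfl⟩), inl E'⟩
      · exact hl.step hs
    · exact hl
    · exact ⟨fun hs => (step_var hs).elim, id⟩
  have hr' : ∀ o, StrongMatch (SubstRel θ σ) (θ o) (σ o) := by
    rintro (_ | _ | w)
    · refine ⟨fun hs => ?_, fun hw => eM.2 (eD.1 hw)⟩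
      rcases hD.1 hs with ⟨rfl, rfl⟩ | ⟨E', h, rfl⟩
      · exact ⟨_, hM.2 (.inl ⟨rfl, rfl⟩), inl (var none)⟩
      · exact ⟨_, hM.2 (.inr (.inl ⟨E', h, rfl⟩)), inl E'⟩
    · exact hr
    · exact ⟨fun hs => (step_var hs).elim, id⟩
  exact ⟨hl.mono fun _ _ => SubstRel.bisimilar hl' hr', hr.mono fun _ _ =>
    SubstRel.bisimilar hr' hl'⟩

end Congruence

/-! ### Silent prefixes in recursions, and collapsing silent cycles -/

section Axioms

variable {A : Type v} {W W' : Type u}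

theorem StrongMatch.bind {S : Term A W' → Term A W' → Prop} {σ θ : W → Term A W'}
    (h : ∀ w, StrongMatch S (σ w) (θ w)) (hS : ∀ G : Term A W, S (G.bind σ) (G.bind θ))
    (G : Term A W) : StrongMatch S (G.bind σ) (G.bind θ) := by
  constructor
  · intro a K hs
    rcases step_bind_iff.1 hs with ⟨G', hs', rfl⟩ | ⟨w, hw, hs⟩
    · exact ⟨_, hs'.bind θ, hS G'⟩
    · obtain ⟨L, h1, h2⟩ := (h w).step hs
      exact ⟨L, hw.bind_step h1, h2⟩
  · intro y hy
    obtain ⟨w, hw, hy⟩ := exposes_bind_iff.1 hy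
    exact hw.bind ((h w).exposes hy)

theorem strongMatch_single {S : Term A W → Term A W → Prop} {P Q : Term A W}
    (h : StrongMatch S P Q) : ∀ o, StrongMatch S (single P o) (single Q o)
  | none => h
  | some _ => ⟨fun hs => (step_var hs).elim, id⟩

/-- Pulling a silent prefix out of a recursion. -/
theorem Cong.mu_pre_tau (E : Term A (Option W)) {θ : Option W → Term A (Option W)}
    (h0 : θ none = .pre .tau (var none)) (h1 : ∀ w, θ (some w) = var (some w)) :
    Cong (.mu (.pre .tau E)) (.pre .tau (.mu (E.bind θ))) := by
  set P : Term A W := .mu (.pre .tau E) with hP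
  set P' : Term A W := .mu (E.bind θ) with hP'
  set Q : Term A W := .pre .tau P' with hQ
  -- The prefix inserted by `θ` turns each substituted `P'` into `Q`, so `P'` unfolds to `E.inst Q`.
  have e : (E.bind θ).inst P' = E.inst Q := by
    rw [Term.inst, bind_bind, Term.inst]
    congr 1
    funext o
    cases o with
    | none => rw [h0]; rfl
    | some w => rw [h1]; rfl
  have hs : ∀ {a K}, Step P' a K ↔ Step (E.inst Q) a K := by
    intro a K
    rw [← e]
    exact step_mu_unfold_iff
  have he : ∀ {w}, Exposes P' w ↔ Exposes (E.inst Q) w := by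
    intro w
    rw [← e]
    exact exposes_mu_unfold_iff
  have sP : ∀ {a K}, Step P a K ↔ a = .tau ∧ K = E.inst P := by
    intro a K
    simp only [hP, step_mu_iff, step_pre_iff]
    constructor
    · rintro ⟨_, ⟨rfl, rfl⟩, rfl⟩
      exact ⟨rfl, rfl⟩
    · rintro ⟨rfl, rfl⟩
      exact ⟨_, ⟨rfl, rfl⟩, rfl⟩
  have eP : ∀ {w}, ¬Exposes P w := by
    intro w
    rw [hP, exposes_mu_iff]
    exact exposes_pre
  -- The extra pair is needed because the step of `Q` ends in the folded `P'`, which only has the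
  -- same moves as `E.inst Q`.
  let R : Term A W → Term A W → Prop := fun u v =>
    (∃ H : Term A (Option W), u = H.inst P ∧ v = H.inst Q) ∨ (u = E.inst P ∧ v = P')
  have hl : StrongMatch R P Q := by
    refine ⟨fun h => ?_, fun h => (eP h).elim⟩
    obtain ⟨rfl, rfl⟩ := sP.1 h
    exact ⟨P', .pre _ _, .inr ⟨rfl, rfl⟩⟩
  have hr : StrongMatch (flip R) Q P := by
    refine ⟨fun h => ?_, fun h => (exposes_pre h).elim⟩
    obtain ⟨rfl, rfl⟩ := step_pre_iff.1 h
    exact ⟨_, sP.2 ⟨rfl, rfl⟩, .inr ⟨rfl, rfl⟩⟩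
  have hl' : ∀ H : Term A (Option W), StrongMatch R (H.inst P) (H.inst Q) :=
    StrongMatch.bind (strongMatch_single hl) fun H => .inl ⟨H, rfl, rfl⟩
  have hr' : ∀ H : Term A (Option W), StrongMatch (flip R) (H.inst Q) (H.inst P) :=
    StrongMatch.bind (strongMatch_single hr) fun H => .inl ⟨H, rfl, rfl⟩
  have hR : ∀ {u v}, R u v → Bisimilar u v := by
    refine bisimilar_of_strongMatch (fun {u v} h => ?_) (fun {u v} h => ?_)
    · refine StrongMatch.mono (S := R) ?_ fun _ _ => .inl
      rcases h with ⟨H, rfl, rfl⟩ | ⟨rfl, rfl⟩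
      · exact hl' H
      · exact (hl' E).trans_incl ⟨fun h => ⟨_, hs.2 h, rfl⟩, he.2⟩
    · refine StrongMatch.mono (S := flip R) ?_ fun _ _ => .inl
      rcases h with ⟨H, rfl, rfl⟩ | ⟨rfl, rfl⟩
      · exact hr' H
      · exact StrongMatch.incl_trans ⟨fun h => ⟨_, hs.1 h, rfl⟩, he.1⟩ (hr' E)
  exact ⟨hl.mono fun _ _ => hR, hr.mono fun _ _ h => (hR h).symm⟩

/-- Instances of the same expression under `σ` and `θ`, or elements of `C × D`. -/
def CollapseRel (σ θ : W → Term A W') (C D : Set (Term A W')) (u v : Term A W') : Prop :=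
  (∃ H : Term A W, u = H.bind σ ∧ v = H.bind θ) ∨ (u ∈ C ∧ v ∈ D)

/-- Two substitutions yield bisimilar expressions if they match strongly after identifying the
elements of `C` and `D`, two sets that consist of mutually silently reachable processes. -/
theorem CollapseRel.bisimilar {σ θ : W → Term A W'} {C D : Set (Term A W')}
    (hC : ∀ {u u'}, u ∈ C → u' ∈ C → TransGen Tau u u')
    (hD : ∀ {v v'}, v ∈ D → v' ∈ D → TransGen Tau v v')
    (h : ∀ w, StrongMatch (CollapseRel σ θ C D) (σ w) (θ w))
    (h' : ∀ w, StrongMatch (flip (CollapseRel σ θ C D)) (θ w) (σ w))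
    (hstep : ∀ {u}, u ∈ C → ∀ {a u'}, Step u a u' →
      (a = .tau ∧ u' ∈ C) ∨ ∃ v ∈ D, ∃ v', Step v a v' ∧ CollapseRel σ θ C D u' v')
    (hstep' : ∀ {v}, v ∈ D → ∀ {a v'}, Step v a v' →
      (a = .tau ∧ v' ∈ D) ∨ ∃ u ∈ C, ∃ u', Step u a u' ∧ CollapseRel σ θ C D u' v')
    (hexp : ∀ {u}, u ∈ C → ∀ {w}, Exposes u w → ∃ v ∈ D, Exposes v w)
    (hexp' : ∀ {v}, v ∈ D → ∀ {w}, Exposes v w → ∃ u ∈ C, Exposes u w) {u v : Term A W'}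
    (huv : CollapseRel σ θ C D u v) : Bisimilar u v := by
  have hl := StrongMatch.bind h fun G => .inl ⟨G, rfl, rfl⟩
  have hr := StrongMatch.bind h' fun G => .inl ⟨G, rfl, rfl⟩
  refine bisimilar_of_progress
    ((progress_of_collapse (R := CollapseRel σ θ C D) (S := CollapseRel σ θ C D)
      (fun _ _ => id) (fun hu hv => .inr ⟨hu, hv⟩) hD ?_ hstep hexp).mono fun _ _ => .inl)
    ((progress_of_collapse (R := flip (CollapseRel σ θ C D)) (S := flip (CollapseRel σ θ C D))
      (fun _ _ => id) (fun hv hu => .inr ⟨hu, hv⟩) hC ?_ hstep' hexp').mono fun _ _ => .inl) huv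
  · rintro _ _ (⟨H, rfl, rfl⟩ | h)
    exacts [.inr (hl H), .inl h]
  · rintro _ _ (⟨H, rfl, rfl⟩ | h)
    exacts [.inr (hr H), .inl h.symm]

/-- `E` silently reaches an expression that exposes `w`. -/
def WeakExposes (E : Term A W) (w : W) : Prop := ∃ E', ReflTransGen Tau E E' ∧ Exposes E' w

theorem reflTransGen_bind {E E' : Term A W} (h : ReflTransGen Tau E E') (σ : W → Term A W') :
    ReflTransGen Tau (E.bind σ) (E'.bind σ) :=
  h.lift (fun E => E.bind σ) fun _ _ hs => hs.bind σ

theorem transGen_bind {E E' : Term A W} (h : TransGen Tau E E') (σ : W → Term A W') :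
    TransGen Tau (E.bind σ) (E'.bind σ) :=
  h.lift (fun E => E.bind σ) fun _ _ hs => hs.bind σ

theorem WeakExposes.bind_transGen {E : Term A W} {w : W} (h : WeakExposes E w)
    {σ : W → Term A W'} {K : Term A W'} (hK : Tau (σ w) K) : TransGen Tau (E.bind σ) K := by
  obtain ⟨E', h1, h2⟩ := h
  exact TransGen.tail' (reflTransGen_bind h1 σ) (h2.bind_step hK)

/-- From `E.inst P` a silent path returns through the exposed variable, by the step of `P` to `c`.
Thus `c`, `E.inst P` and the silent derivatives of `E` that can still return form a cycle, matching
the cycle through `d`. The recursions `P` and `P'` stay outside the cycles, since `G` may add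
behaviour to them. -/
theorem Cong.mu_tau_tau {E F G : Term A (Option W)} (hE : WeakExposes E none) :
    Cong (.mu (.sum (.pre .tau (.sum (.pre .tau E) F)) G))
      (.mu (.sum (.pre .tau (.sum E F)) G)) := by
  set P : Term A W := .mu (.sum (.pre .tau (.sum (.pre .tau E) F)) G) with hP
  set P' : Term A W := .mu (.sum (.pre .tau (.sum E F)) G) with hP'
  let c : Term A W := .sum (.pre .tau (E.inst P)) (F.inst P)
  let d : Term A W := .sum (E.inst P') (F.inst P')
  let C : Set (Term A W) := {u | u = c ∨ ∃ K, (ReflTransGen Tau E K ∧ WeakExposes K none) ∧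
    u = K.inst P}
  -- The path from `E` must be nonempty here: `d` contains the moves of `E.inst P'` as a summand but
  -- need not reach that process.
  let D : Set (Term A W) := {v | v = d ∨ ∃ K, (TransGen Tau E K ∧ WeakExposes K none) ∧
    v = K.inst P'}
  have hcC : c ∈ C := .inl rfl
  have hEC : E.inst P ∈ C := .inr ⟨E, ⟨.refl, hE⟩, rfl⟩
  have hdD : d ∈ D := .inl rfl
  have sP : ∀ {a K}, Step P a K ↔ (a = .tau ∧ K = c) ∨ ∃ G', Step G a G' ∧ K = G'.inst P := by
    intro a K
    simp only [hP, step_mu_iff, step_sum_iff, step_pre_iff]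
    constructor
    · rintro ⟨_, ⟨rfl, rfl⟩ | h, rfl⟩
      exacts [.inl ⟨rfl, rfl⟩, .inr ⟨_, h, rfl⟩]
    · rintro (⟨rfl, rfl⟩ | ⟨_, h, rfl⟩)
      exacts [⟨_, .inl ⟨rfl, rfl⟩, rfl⟩, ⟨_, .inr h, rfl⟩]
  have sP' : ∀ {a K}, Step P' a K ↔ (a = .tau ∧ K = d) ∨ ∃ G', Step G a G' ∧ K = G'.inst P' := by
    intro a K
    simp only [hP', step_mu_iff, step_sum_iff, step_pre_iff]
    constructor
    · rintro ⟨_, ⟨rfl, rfl⟩ | h, rfl⟩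
      exacts [.inl ⟨rfl, rfl⟩, .inr ⟨_, h, rfl⟩]
    · rintro (⟨rfl, rfl⟩ | ⟨_, h, rfl⟩)
      exacts [⟨_, .inl ⟨rfl, rfl⟩, rfl⟩, ⟨_, .inr h, rfl⟩]
  have eP : ∀ {w}, Exposes P w ↔ Exposes G (some w) := by
    simp only [hP, exposes_mu_iff, exposes_sum_iff, exposes_pre, false_or, implies_true]
  have eP' : ∀ {w}, Exposes P' w ↔ Exposes G (some w) := by
    simp only [hP', exposes_mu_iff, exposes_sum_iff, exposes_pre, false_or, implies_true]
  have hPc : Tau P c := sP.2 (.inl ⟨rfl, rfl⟩)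
  have hPd : Tau P' d := sP'.2 (.inl ⟨rfl, rfl⟩)
  have hC : ∀ {u u'}, u ∈ C → u' ∈ C → TransGen Tau u u' := by
    have hcE : ∀ {K}, ReflTransGen Tau E K → TransGen Tau c (K.inst P) := fun h =>
      TransGen.head' (.sum_left (.pre _ _)) (reflTransGen_bind h _)
    have h1 : ∀ {u}, u ∈ C → TransGen Tau u c := by
      rintro _ (rfl | ⟨K, ⟨h, h'⟩, rfl⟩)
      · exact (hcE .refl).trans (hE.bind_transGen hPc)
      · exact h'.bind_transGen hPc
    have h2 : ∀ {u}, u ∈ C → TransGen Tau c u := by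
      rintro _ (rfl | ⟨K, ⟨h, h'⟩, rfl⟩)
      · exact h1 hcC
      · exact hcE h
    exact fun {_ _} hu hu' => (h1 hu).trans (h2 hu')
  have hD : ∀ {v v'}, v ∈ D → v' ∈ D → TransGen Tau v v' := by
    have hdE : ∀ {K}, TransGen Tau (E.inst P') K → TransGen Tau d K := by
      intro K h
      obtain ⟨L, h1, h2⟩ := TransGen.head'_iff.1 h
      exact TransGen.head' (.sum_left h1) h2
    have h1 : ∀ {v}, v ∈ D → TransGen Tau v d := by
      rintro _ (rfl | ⟨K, ⟨h, h'⟩, rfl⟩)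
      · exact hdE (hE.bind_transGen hPd)
      · exact h'.bind_transGen hPd
    have h2 : ∀ {v}, v ∈ D → TransGen Tau d v := by
      rintro _ (rfl | ⟨K, ⟨h, h'⟩, rfl⟩)
      · exact h1 hdD
      · exact hdE (transGen_bind h _)
    exact fun {_ _} hv hv' => (h1 hv).trans (h2 hv')
  have inst_rel : ∀ H : Term A (Option W),
      CollapseRel (single P) (single P') C D (H.inst P) (H.inst P') := fun H => .inl ⟨H, rfl, rfl⟩
  have hl : StrongMatch (CollapseRel (single P) (single P') C D) P P' := by
    refine ⟨fun hs => ?_, fun hw => eP'.2 (eP.1 hw)⟩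
    rcases sP.1 hs with ⟨rfl, rfl⟩ | ⟨G', h, rfl⟩
    exacts [⟨d, hPd, .inr ⟨hcC, hdD⟩⟩, ⟨_, sP'.2 (.inr ⟨G', h, rfl⟩), inst_rel G'⟩]
  have hr : StrongMatch (flip (CollapseRel (single P) (single P') C D)) P' P := by
    refine ⟨fun hs => ?_, fun hw => eP.2 (eP'.1 hw)⟩
    rcases sP'.1 hs with ⟨rfl, rfl⟩ | ⟨G', h, rfl⟩
    exacts [⟨c, hPc, .inr ⟨hcC, hdD⟩⟩, ⟨_, sP.2 (.inr ⟨G', h, rfl⟩), inst_rel G'⟩]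
  have hl' : ∀ H : Term A (Option W), StrongMatch _ (H.inst P) (H.inst P') :=
    StrongMatch.bind (strongMatch_single hl) inst_rel
  have hr' : ∀ H : Term A (Option W), StrongMatch _ (H.inst P') (H.inst P) :=
    StrongMatch.bind (strongMatch_single hr) inst_rel
  -- The empty path, excluded from `D`, is covered by `d`, which has all moves of `E.inst P'`.
  have cover : ∀ {K}, ReflTransGen Tau E K → WeakExposes K none →
      ∃ v ∈ D, StrongMatch Eq (K.inst P') v := by
    intro K h h'
    rcases reflTransGen_iff_eq_or_transGen.1 h with rfl | h
    · exact ⟨d, hdD, fun hs => ⟨_, .sum_left hs, rfl⟩, .sum_left⟩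
    · exact ⟨_, .inr ⟨K, ⟨h, h'⟩, rfl⟩, fun hs => ⟨_, hs, rfl⟩, id⟩
  have hR : ∀ {u v}, CollapseRel (single P) (single P') C D u v → Bisimilar u v := by
    refine CollapseRel.bisimilar hC hD (strongMatch_single hl) (strongMatch_single hr)
      ?_ ?_ ?_ ?_
    · rintro _ (rfl | ⟨K, ⟨h, h'⟩, rfl⟩) a u' hs
      · rcases step_sum_iff.1 hs with hs | hs
        · obtain ⟨rfl, rfl⟩ := step_pre_iff.1 hs
          exact .inl ⟨rfl, hEC⟩
        · obtain ⟨v', h1, h2⟩ := (hl' F).step hs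
          exact .inr ⟨d, hdD, v', .sum_right h1, h2⟩
      · obtain ⟨v, hv, hm⟩ := cover h h'
        obtain ⟨v', h1, h2⟩ := ((hl' K).trans_incl hm).step hs
        exact .inr ⟨v, hv, v', h1, h2⟩
    · rintro _ (rfl | ⟨K, ⟨h, h'⟩, rfl⟩) a v' hs
      · rcases step_sum_iff.1 hs with hs | hs
        · obtain ⟨u', h1, h2⟩ := (hr' E).step hs
          exact .inr ⟨_, hEC, u', h1, h2⟩
        · obtain ⟨u', h1, h2⟩ := (hr' F).step hs
          exact .inr ⟨c, hcC, u', .sum_right h1, h2⟩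
      · obtain ⟨u', h1, h2⟩ := (hr' K).step hs
        exact .inr ⟨_, .inr ⟨K, ⟨h.to_reflTransGen, h'⟩, rfl⟩, u', h1, h2⟩
    · rintro _ (rfl | ⟨K, ⟨h, h'⟩, rfl⟩) w hw
      · exact ⟨d, hdD, .sum_right
          ((hl' F).exposes ((exposes_sum_iff.1 hw).resolve_left exposes_pre))⟩
      · obtain ⟨v, hv, hm⟩ := cover h h'
        exact ⟨v, hv, hm.exposes ((hl' K).exposes hw)⟩
    · rintro _ (rfl | ⟨K, ⟨h, h'⟩, rfl⟩) w hw
      · rcases exposes_sum_iff.1 hw with hw | hw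
        · exact ⟨_, hEC, (hr' E).exposes hw⟩
        · exact ⟨c, hcC, .sum_right ((hr' F).exposes hw)⟩
      · exact ⟨_, .inr ⟨K, ⟨h.to_reflTransGen, h'⟩, rfl⟩, (hr' K).exposes hw⟩
  exact ⟨hl.mono fun _ _ => hR, hr.mono fun _ _ h => (hR h).symm⟩

end Axioms

/-! ### Unique solutions of guarded equations -/

section UniqueSolution

variable {A : Type v} {W W' : Type u}

/-- Every free occurrence of the variable lies below a visible prefix. -/
def Guarded {A : Type v} {W : Type u} : Term A W → W → Prop
  | nil, _ => True
  | var y, w => y ≠ w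
  | pre a E, w => a ≠ .tau ∨ Guarded E w
  | sum E F, w => Guarded E w ∧ Guarded F w
  | mu E, w => Guarded E (some w)

theorem Guarded.bind {E : Term A W} {σ : W → Term A W'} {w : W'}
    (h : ∀ y, Guarded (σ y) w ∨ Guarded E y) : Guarded (E.bind σ) w := by
  induction E generalizing W' with
  | nil => trivial
  | var y => exact (h y).resolve_right fun h => h rfl
  | pre a E ih =>
    by_cases ha : a = .tau
    · exact .inr (ih fun y => (h y).imp_right fun h => h.resolve_left fun h => h ha)
    · exact .inl ha
  | sum E F ihE ihF =>
    exact ⟨ihE fun y => (h y).imp_right And.left, ihF fun y => (h y).imp_right And.right⟩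
  | mu E ih =>
    refine ih (w := some w) ?_
    rintro (_ | y)
    · exact .inl fun h => nomatch h
    · refine (h y).imp_left fun h => ?_
      have key : ∀ {W W' : Type u} (E : Term A W) {f : W → W'}, Function.Injective f →
          ∀ {w : W}, Guarded E w → Guarded (E.rename f) (f w) := by
        intro W W' E
        induction E generalizing W' with
        | nil => exact fun _ _ _ => trivial
        | var y => exact fun hf _ h => hf.ne h
        | pre a E ih => exact fun hf _ h => h.imp_right (ih hf)
        | sum E F ihE ihF => exact fun hf _ h => ⟨ihE hf h.1, ihF hf h.2⟩
        | mu E ih =>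
          intro f hf w h
          exact ih (Option.map_injective hf) h
      exact key _ (Option.some_injective _) h

theorem Guarded.inst_mu {E : Term A (Option W)} {w : W} (h : Guarded (mu E) w) :
    Guarded (E.inst (mu E)) w := by
  refine Guarded.bind ?_
  rintro (_ | y)
  · exact .inl h
  · by_cases hy : y = w
    · subst hy
      exact .inr h
    · exact .inl hy

theorem Guarded.not_exposes {E : Term A W} {w : W} (h : Guarded E w) : ¬Exposes E w := by
  intro hw
  induction hw with
  | var w => exact h rfl
  | sum_left _ ih => exact ih h.1
  | sum_right _ ih => exact ih h.2
  | mu _ ih => exact ih h.inst_mu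

/-- Removing a silent prefix exposes nothing that was guarded, because only visible prefixes guard.
-/
theorem Guarded.tau {E E' : Term A W} {w : W} (h : Guarded E w) (hs : Tau E E') :
    Guarded E' w := by
  unfold Tau at hs
  generalize ha : Act.tau = a at hs
  induction hs with
  | pre a E => exact h.resolve_left fun h => h ha.symm
  | sum_left _ ih => exact ih h.1 ha
  | sum_right _ ih => exact ih h.2 ha
  | mu _ ih => exact ih h.inst_mu ha

theorem Guarded.tauStar_inst {G : Term A (Option W)} (h : Guarded G none) {Q Y : Term A W}
    (hs : ReflTransGen Tau (G.inst Q) Y) :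
    ∃ G', ReflTransGen Tau G G' ∧ Guarded G' none ∧ Y = G'.inst Q := by
  induction hs with
  | refl => exact ⟨G, .refl, h, rfl⟩
  | tail _ hs ih =>
    obtain ⟨G', h1, h2, rfl⟩ := ih
    rcases step_inst_iff.1 hs with ⟨G'', hs', rfl⟩ | ⟨hw, _⟩
    · exact ⟨G'', h1.tail hs', h2.tau hs', rfl⟩
    · exact (h2.not_exposes hw).elim

theorem Guarded.tauPlus_inst {G : Term A (Option W)} (h : Guarded G none) {Q Y : Term A W}
    (hs : TransGen Tau (G.inst Q) Y) :
    ∃ G', TransGen Tau G G' ∧ Guarded G' none ∧ Y = G'.inst Q := by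
  obtain ⟨Z, h1, h2⟩ := TransGen.head'_iff.1 hs
  rcases step_inst_iff.1 h1 with ⟨G', hs', rfl⟩ | ⟨hw, _⟩
  · obtain ⟨G'', h3, h4, e⟩ := (h.tau hs').tauStar_inst h2
    exact ⟨G'', TransGen.head' hs' h3, h4, e⟩
  · exact (h.not_exposes hw).elim

/-- Instances of a common expression with `Q` and with `P`, up to bisimilarity. -/
def SolutionRel (Q P U V : Term A W) : Prop :=
  ∃ G : Term A (Option W), Bisimilar U (G.inst Q) ∧ Bisimilar (G.inst P) V

theorem SolutionRel.symm {Q P U V : Term A W} (h : SolutionRel Q P U V) : SolutionRel P Q V U := by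
  obtain ⟨G, h1, h2⟩ := h
  exact ⟨G, h2.symm, h1.symm⟩

section

variable {E : Term A (Option W)} {P Q : Term A W}

/-- Substituting `E` for the variable once more makes the context guarded, and changes its instances
only up to congruence because `Q` and `P` solve the equation. -/
theorem SolutionRel.exists_guarded (hE : Guarded E none) (hQ : Cong Q (E.inst Q))
    (hP : Cong P (E.inst P)) {U V : Term A W} (h : SolutionRel Q P U V) :
    ∃ G : Term A (Option W), Guarded G none ∧ Bisimilar U (G.inst Q) ∧ Bisimilar (G.inst P) V := by
  obtain ⟨G, h1, h2⟩ := h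
  let θ : Option W → Term A (Option W) := fun o => o.elim E fun w => var (some w)
  have e : ∀ P : Term A W, (G.bind θ).inst P = G.inst (E.inst P) := by
    intro P
    rw [inst, bind_bind]
    change _ = G.bind _
    congr 1
    funext o
    cases o <;> rfl
  refine ⟨G.bind θ, Guarded.bind ?_, ?_, ?_⟩
  · rintro (_ | w)
    exacts [.inl hE, .inl fun h => nomatch h]
  · rw [e]
    exact h1.trans ((Cong.refl G).inst hQ).bisimilar
  · rw [e]
    exact ((Cong.refl G).inst hP).symm.bisimilar.trans h2

/-- With a guarded context, the silent moves of `G.inst Q` and the move following them belong to the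
context, so `G.inst P` can make them too. A visible move may destroy guardedness, which is restored
at the next round. -/
theorem progress_solutionRel (hE : Guarded E none) (hQ : Cong Q (E.inst Q))
    (hP : Cong P (E.inst P)) : Progress (SolutionRel Q P) (SolutionRel Q P) := by
  refine ⟨?_, ?_, ?_⟩
  · intro U V h a U' hs
    obtain ⟨G, hG, h1, h2⟩ := h.exists_guarded hE hQ hP
    rcases progress_bisimilar.step h1 hs with ⟨rfl, Y, h3, h4, h5⟩ | ⟨Y, Y', h3, hs', h4, h5⟩
    · obtain ⟨G', h6, _, rfl⟩ := hG.tauStar_inst h3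
      obtain ⟨V', h7, h8⟩ := h2.tauStar (reflTransGen_bind h6 _)
      exact .inl ⟨rfl, V', h7, ⟨G', h4, h8⟩, G', h5, h8⟩
    · obtain ⟨G', h6, hG', rfl⟩ := hG.tauStar_inst h3
      obtain ⟨V', h7, h8⟩ := h2.tauStar (reflTransGen_bind h6 _)
      rcases step_inst_iff.1 hs' with ⟨G'', hs'', rfl⟩ | ⟨hw, _⟩
      · rcases progress_bisimilar.step h8 (hs''.bind _) with
          ⟨rfl, V'', h9, h10, h11⟩ | ⟨V'', V''', h9, h10, h11, h12⟩
        · exact .inl ⟨rfl, V'', h7.trans h9, ⟨G', h4, h10⟩, G'', h5, h11⟩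
        · exact .inr ⟨V'', V''', h7.trans h9, h10, ⟨G', h4, h11⟩, G'', h5, h12⟩
      · exact (hG'.not_exposes hw).elim
  · intro U V h w hw
    obtain ⟨G, hG, h1, h2⟩ := h.exists_guarded hE hQ hP
    obtain ⟨Y, h3, h4, h5⟩ := progress_bisimilar.exposes h1 hw
    obtain ⟨G', h6, hG', rfl⟩ := hG.tauStar_inst h3
    obtain ⟨V', h7, h8⟩ := h2.tauStar (reflTransGen_bind h6 _)
    have h9 := (exposes_inst_iff.1 h5).resolve_right fun h => hG'.not_exposes h.1
    obtain ⟨V'', h10, h11, h12⟩ := progress_bisimilar.exposes h8 (exposes_inst_iff.2 (.inl h9))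
    exact ⟨V'', h7.trans h10, ⟨G', h4, h11⟩, h12⟩
  · intro U V h r h0 hr
    obtain ⟨G, hG, h1, h2⟩ := h.exists_guarded hE hQ hP
    obtain ⟨_, V', ⟨j, G', _, h3, rfl⟩, h4, h5⟩ :=
      -- Guardedness survives silent moves, so the answers to the successive parts of the run chain
      -- into actual silent paths between instances with `P`, without renewing the context.
      exists_tauPlus_of_weak (N := fun u => ∃ j, ∃ G : Term A (Option W),
        Guarded G none ∧ Bisimilar (r j) (G.inst Q) ∧ u = G.inst P) (by
        rintro _ ⟨j, G, hG, hj, rfl⟩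
        obtain ⟨k, Y, h1, h2⟩ := progress_bisimilar.run hj (fun i => r (j + i)) rfl
          fun i => hr (j + i)
        obtain ⟨G', h3, hG', rfl⟩ := hG.tauPlus_inst h1
        exact ⟨_, transGen_bind h3 _, j + k, G', hG', h2, rfl⟩)
        ⟨0, G, hG, h0.symm ▸ h1, rfl⟩ h2
    exact ⟨j, V', h4, G', h3, h5⟩

/-- Guarded equations have unique solutions. -/
theorem Cong.of_solutions (hE : Guarded E none) (hQ : Cong Q (E.inst Q))
    (hP : Cong P (E.inst P)) : Cong Q P := by
  have key : ∀ {P Q : Term A W}, Cong Q (E.inst Q) → Cong P (E.inst P) →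
      StrongMatch Bisimilar Q P := by
    intro P Q hQ hP
    have hR : ∀ {U V}, SolutionRel Q P U V → Bisimilar U V :=
      bisimilar_of_progress ((progress_solutionRel hE hQ hP).mono fun _ _ => .inl)
        (((progress_solutionRel hE hP hQ).mono fun _ _ h => .inl h.symm).anti
          fun _ _ (h : SolutionRel Q P _ _) => h.symm)
    constructor
    · intro a K hs
      -- The rooted first step passes through the equation: guardedness makes it a transition of
      -- `E`, which `P` then shares.
      obtain ⟨L, h1, h2⟩ := hQ.left.step hs
      rcases step_inst_iff.1 h1 with ⟨E', hs', rfl⟩ | ⟨hw, _⟩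
      · obtain ⟨L', h3, h4⟩ := hP.right.step (step_inst_iff.2 (.inl ⟨E', hs', rfl⟩))
        exact ⟨L', h3, hR ⟨E', h2, h4⟩⟩
      · exact (hE.not_exposes hw).elim
    · intro w hw
      rcases exposes_inst_iff.1 (hQ.left.exposes hw) with hw | ⟨hw, _⟩
      · exact hP.right.exposes (exposes_inst_iff.2 (.inl hw))
      · exact (hE.not_exposes hw).elim
  exact ⟨key hQ hP, key hP hQ⟩

end

end UniqueSolution

/-! ### Removing a silent loop from a process that already diverges -/

section Divergence

variable {A : Type v} {W : Type u}

/-- Because `E` weakly exposes the outer variable, `d` can silently return to itself through `P'`.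
It diverges without the loop that `c` has, and this loop can be answered by a step inside the cycle
of `d`. -/
theorem Cong.mu_tau_mu {E : Term A (Option (Option W))} {F : Term A (Option W)}
    (hE : WeakExposes E (some none)) :
    Cong (.mu (.sum (.pre .tau (.mu (.sum (.pre .tau (var none)) E))) F))
      (.mu (.sum (.pre .tau (.mu E)) F)) := by
  set M : Term A (Option W) := .mu (.sum (.pre .tau (var none)) E) with hM
  set N : Term A (Option W) := .mu E with hN
  set P : Term A W := .mu (.sum (.pre .tau M) F) with hP
  set P' : Term A W := .mu (.sum (.pre .tau N) F) with hP'
  let c : Term A W := M.inst P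
  let d : Term A W := N.inst P'
  let σ := double c P
  let θ := double d P'
  let C : Set (Term A W) := {u | u = c ∨ ∃ K, (TransGen Tau E K ∧ WeakExposes K (some none)) ∧
    u = K.bind σ}
  let D : Set (Term A W) := {v | v = d ∨ ∃ K, (TransGen Tau E K ∧ WeakExposes K (some none)) ∧
    v = K.bind θ}
  have hcC : c ∈ C := .inl rfl
  have hdD : d ∈ D := .inl rfl
  have sP : ∀ {a K}, Step P a K ↔ (a = .tau ∧ K = c) ∨ ∃ F', Step F a F' ∧ K = F'.inst P := by
    intro a K
    simp only [hP, step_mu_iff, step_sum_iff, step_pre_iff]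
    constructor
    · rintro ⟨_, ⟨rfl, rfl⟩ | h, rfl⟩
      exacts [.inl ⟨rfl, rfl⟩, .inr ⟨_, h, rfl⟩]
    · rintro (⟨rfl, rfl⟩ | ⟨_, h, rfl⟩)
      exacts [⟨_, .inl ⟨rfl, rfl⟩, rfl⟩, ⟨_, .inr h, rfl⟩]
  have sP' : ∀ {a K}, Step P' a K ↔ (a = .tau ∧ K = d) ∨ ∃ F', Step F a F' ∧ K = F'.inst P' := by
    intro a K
    simp only [hP', step_mu_iff, step_sum_iff, step_pre_iff]
    constructor
    · rintro ⟨_, ⟨rfl, rfl⟩ | h, rfl⟩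
      exacts [.inl ⟨rfl, rfl⟩, .inr ⟨_, h, rfl⟩]
    · rintro (⟨rfl, rfl⟩ | ⟨_, h, rfl⟩)
      exacts [⟨_, .inl ⟨rfl, rfl⟩, rfl⟩, ⟨_, .inr h, rfl⟩]
  have eP : ∀ {w}, Exposes P w ↔ Exposes F (some w) := by
    simp only [hP, exposes_mu_iff, exposes_sum_iff, exposes_pre, false_or, implies_true]
  have eP' : ∀ {w}, Exposes P' w ↔ Exposes F (some w) := by
    simp only [hP', exposes_mu_iff, exposes_sum_iff, exposes_pre, false_or, implies_true]
  have sc : ∀ {a K}, Step c a K ↔ (a = .tau ∧ K = c) ∨ (∃ E', Step E a E' ∧ K = E'.bind σ) ∨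
      (Exposes E (some none) ∧ Step P a K) := by
    intro a K
    simp only [c, step_inst_iff, hM, step_mu_iff, exposes_mu_iff, exposes_sum_iff, exposes_pre,
      step_sum_iff, step_pre_iff, false_or]
    rw [← or_assoc]
    refine or_congr_left ⟨?_, ?_⟩
    · rintro ⟨_, ⟨E', ⟨rfl, rfl⟩ | h, rfl⟩, rfl⟩
      · exact .inl ⟨rfl, rfl⟩
      · exact .inr ⟨E', h, inst_inst _ _ _⟩
    · rintro (⟨rfl, rfl⟩ | ⟨E', h, rfl⟩)
      · exact ⟨_, ⟨_, .inl ⟨rfl, rfl⟩, rfl⟩, rfl⟩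
      · exact ⟨_, ⟨_, .inr h, rfl⟩, (inst_inst _ _ _).symm⟩
  have sd : ∀ {a K}, Step d a K ↔ (∃ E', Step E a E' ∧ K = E'.bind θ) ∨
      (Exposes E (some none) ∧ Step P' a K) := by
    intro a K
    simp only [d, step_inst_iff, hN, step_mu_iff, exposes_mu_iff]
    refine or_congr_left ⟨?_, ?_⟩
    · rintro ⟨_, ⟨E', h, rfl⟩, rfl⟩
      exact ⟨E', h, inst_inst _ _ _⟩
    · rintro ⟨E', h, rfl⟩
      exact ⟨_, ⟨E', h, rfl⟩, (inst_inst _ _ _).symm⟩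
  have ec : ∀ {w}, Exposes c w ↔ Exposes E (some (some w)) ∨
      (Exposes E (some none) ∧ Exposes P w) := by
    intro w
    simp only [c, exposes_inst_iff, hM, exposes_mu_iff, exposes_sum_iff, exposes_pre, false_or]
  have ed : ∀ {w}, Exposes d w ↔ Exposes E (some (some w)) ∨
      (Exposes E (some none) ∧ Exposes P' w) := by
    intro w
    simp only [d, exposes_inst_iff, hN, exposes_mu_iff]
  have hPc : Tau P c := sP.2 (.inl ⟨rfl, rfl⟩)
  have hPd : Tau P' d := sP'.2 (.inl ⟨rfl, rfl⟩)
  have hcE : ∀ {K}, TransGen Tau E K → TransGen Tau c (K.bind σ) := by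
    intro K h
    obtain ⟨L, h1, h2⟩ := TransGen.head'_iff.1 h
    exact TransGen.head' (sc.2 (.inr (.inl ⟨L, h1, rfl⟩))) (reflTransGen_bind h2 σ)
  have hdE : ∀ {K}, TransGen Tau E K → TransGen Tau d (K.bind θ) := by
    intro K h
    obtain ⟨L, h1, h2⟩ := TransGen.head'_iff.1 h
    exact TransGen.head' (sd.2 (.inl ⟨L, h1, rfl⟩)) (reflTransGen_bind h2 θ)
  have hC : ∀ {u u'}, u ∈ C → u' ∈ C → TransGen Tau u u' := by
    have hcc : Tau c c := sc.2 (.inl ⟨rfl, rfl⟩)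
    have h1 : ∀ {u}, u ∈ C → TransGen Tau u c := by
      rintro _ (rfl | ⟨K, ⟨h, h'⟩, rfl⟩)
      exacts [.single hcc, h'.bind_transGen hPc]
    have h2 : ∀ {u}, u ∈ C → TransGen Tau c u := by
      rintro _ (rfl | ⟨K, ⟨h, h'⟩, rfl⟩)
      exacts [.single hcc, hcE h]
    exact fun {_ _} hu hu' => (h1 hu).trans (h2 hu')
  -- The answer to the loop at `c`: the first step of the path from `E` to the exposed variable or,
  -- if that path is empty, the step inherited from `P'`.
  have hdD' : ∃ v ∈ D, Tau d v := by
    obtain ⟨E', h1, h2⟩ := hE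
    rcases ReflTransGen.cases_head h1 with rfl | ⟨K, h3, h4⟩
    · exact ⟨d, hdD, sd.2 (.inr ⟨h2, hPd⟩)⟩
    · exact ⟨_, .inr ⟨K, ⟨.single h3, E', h4, h2⟩, rfl⟩, sd.2 (.inl ⟨K, h3, rfl⟩)⟩
  have hD : ∀ {v v'}, v ∈ D → v' ∈ D → TransGen Tau v v' := by
    have hdd : TransGen Tau d d := by
      obtain ⟨v, rfl | ⟨K, ⟨h, h'⟩, rfl⟩, hv⟩ := hdD'
      exacts [.single hv, (hdE h).trans (h'.bind_transGen hPd)]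
    have h1 : ∀ {v}, v ∈ D → TransGen Tau v d := by
      rintro _ (rfl | ⟨K, ⟨h, h'⟩, rfl⟩)
      exacts [hdd, h'.bind_transGen hPd]
    have h2 : ∀ {v}, v ∈ D → TransGen Tau d v := by
      rintro _ (rfl | ⟨K, ⟨h, h'⟩, rfl⟩)
      exacts [hdd, hdE h]
    exact fun {_ _} hv hv' => (h1 hv).trans (h2 hv')
  have bind_rel : ∀ H : Term A (Option (Option W)),
      CollapseRel σ θ C D (H.bind σ) (H.bind θ) := fun H => .inl ⟨H, rfl, rfl⟩
  have inst_eq : ∀ (H : Term A (Option W)) (Q P : Term A W),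
      H.inst P = (H.rename some).bind (double Q P) := by
    intro H Q P
    rw [bind_rename]
    rfl
  have inst_rel : ∀ H : Term A (Option W), CollapseRel σ θ C D (H.inst P) (H.inst P') :=
    fun H => .inl ⟨H.rename some, inst_eq H c P, inst_eq H d P'⟩
  have hl : StrongMatch (CollapseRel σ θ C D) P P' := by
    refine ⟨fun hs => ?_, fun hw => eP'.2 (eP.1 hw)⟩
    rcases sP.1 hs with ⟨rfl, rfl⟩ | ⟨F', h, rfl⟩
    exacts [⟨d, hPd, .inr ⟨hcC, hdD⟩⟩, ⟨_, sP'.2 (.inr ⟨F', h, rfl⟩), inst_rel F'⟩]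
  have hr : StrongMatch (flip (CollapseRel σ θ C D)) P' P := by
    refine ⟨fun hs => ?_, fun hw => eP.2 (eP'.1 hw)⟩
    rcases sP'.1 hs with ⟨rfl, rfl⟩ | ⟨F', h, rfl⟩
    exacts [⟨c, hPc, .inr ⟨hcC, hdD⟩⟩, ⟨_, sP.2 (.inr ⟨F', h, rfl⟩), inst_rel F'⟩]
  have hlv : ∀ o, StrongMatch (CollapseRel σ θ C D) (σ o) (θ o) := by
    rintro (_ | _ | w)
    · refine ⟨fun hs => ?_, fun hw => ed.2 ((ec.1 hw).imp_right (.imp_right hl.exposes))⟩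
      rcases sc.1 hs with ⟨rfl, rfl⟩ | ⟨E', h, rfl⟩ | ⟨hw, hs⟩
      · obtain ⟨v, hv, hdv⟩ := hdD'
        exact ⟨v, hdv, .inr ⟨hcC, hv⟩⟩
      · exact ⟨_, sd.2 (.inl ⟨E', h, rfl⟩), bind_rel E'⟩
      · obtain ⟨L, h1, h2⟩ := hl.step hs
        exact ⟨L, sd.2 (.inr ⟨hw, h1⟩), h2⟩
    · exact hl
    · exact ⟨fun hs => (step_var hs).elim, id⟩
  have hrv : ∀ o, StrongMatch (flip (CollapseRel σ θ C D)) (θ o) (σ o) := by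
    rintro (_ | _ | w)
    · refine ⟨fun hs => ?_, fun hw => ec.2 ((ed.1 hw).imp_right (.imp_right hr.exposes))⟩
      rcases sd.1 hs with ⟨E', h, rfl⟩ | ⟨hw, hs⟩
      · exact ⟨_, sc.2 (.inr (.inl ⟨E', h, rfl⟩)), bind_rel E'⟩
      · obtain ⟨L, h1, h2⟩ := hr.step hs
        exact ⟨L, sc.2 (.inr (.inr ⟨hw, h1⟩)), h2⟩
    · exact hr
    · exact ⟨fun hs => (step_var hs).elim, id⟩
  have hl' := StrongMatch.bind hlv bind_rel
  have hr' := StrongMatch.bind hrv bind_rel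
  have mem_C : ∀ {v}, v ∈ D → ∃ u ∈ C, StrongMatch (flip (CollapseRel σ θ C D)) v u := by
    rintro _ (rfl | ⟨K, h, rfl⟩)
    exacts [⟨c, hcC, hrv none⟩, ⟨_, .inr ⟨K, h, rfl⟩, hr' K⟩]
  have mem_D : ∀ {u}, u ∈ C → ∃ v ∈ D, StrongMatch (CollapseRel σ θ C D) u v := by
    rintro _ (rfl | ⟨K, h, rfl⟩)
    exacts [⟨d, hdD, hlv none⟩, ⟨_, .inr ⟨K, h, rfl⟩, hl' K⟩]
  have hR : ∀ {u v}, CollapseRel σ θ C D u v → Bisimilar u v := by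
    refine CollapseRel.bisimilar hC hD hlv hrv ?_ ?_ ?_ ?_
    · intro u hu a u' hs
      obtain ⟨v, hv, hm⟩ := mem_D hu
      obtain ⟨v', h⟩ := hm.step hs
      exact .inr ⟨v, hv, v', h⟩
    · intro v hv a v' hs
      obtain ⟨u, hu, hm⟩ := mem_C hv
      obtain ⟨u', h⟩ := hm.step hs
      exact .inr ⟨u, hu, u', h⟩
    · intro u hu w hw
      obtain ⟨v, hv, hm⟩ := mem_D hu
      exact ⟨v, hv, hm.exposes hw⟩
    · intro v hv w hw
      obtain ⟨u, hu, hm⟩ := mem_C hv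
      exact ⟨u, hu, hm.exposes hw⟩
  exact ⟨hl.mono fun _ _ => hR, hr.mono fun _ _ h => (hR h).symm⟩

end Divergence

end Term

namespace PExpr

/-! ### From raw expressions to well-scoped terms and back -/

section Translation

variable {V W : Type u} {A : Type v} [DecidableEq V]

/-- The well-scoped expression denoted by a raw expression, under an assignment of its free
variables. -/
def toTerm {V : Type u} {A : Type v} [DecidableEq V] :
    PExpr V A → {W : Type u} → (V → W) → Term A W
  | nil, _, _ => .nil
  | var X, _, ρ => .var (ρ X)
  | pre a E, _, ρ => .pre a (toTerm E ρ)
  | sum E F, _, ρ => .sum (toTerm E ρ) (toTerm F ρ)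
  | mu X E, _, ρ => .mu (toTerm E (Function.update (some ∘ ρ) X none))

theorem toTerm_congr (E : PExpr V A) {ρ ρ' : V → W} (h : ∀ X ∈ fv E, ρ X = ρ' X) :
    E.toTerm ρ = E.toTerm ρ' := by
  induction E generalizing W with
  | nil => rfl
  | var X => exact congrArg Term.var (h X (Finset.mem_singleton_self X))
  | pre a E ih => exact congrArg (Term.pre a) (ih h)
  | sum E F ihE ihF =>
    exact congrArg₂ Term.sum (ihE fun X hX => h X (Finset.mem_union_left _ hX))
      (ihF fun X hX => h X (Finset.mem_union_right _ hX))
  | mu Y E ih =>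
    refine congrArg Term.mu (ih fun X hX => ?_)
    by_cases hXY : X = Y
    · subst hXY
      simp
    · simp [hXY, h X (Finset.mem_erase.2 ⟨hXY, hX⟩)]

theorem toTerm_rename {W' : Type u} (E : PExpr V A) (ρ : V → W) (f : W → W') :
    (E.toTerm ρ).rename f = E.toTerm (f ∘ ρ) := by
  induction E generalizing W W' with
  | nil => rfl
  | var X => rfl
  | pre a E ih => simp only [toTerm, Term.rename, ih]
  | sum E F ihE ihF => simp only [toTerm, Term.rename, ihE, ihF]
  | mu X E ih =>
    simp only [toTerm, Term.rename, ih]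
    congr 2
    funext Y
    by_cases h : Y = X
    · subst h
      simp
    · simp [h]

theorem guarded_toTerm (E : PExpr V A) {ρ : V → W} {w : W} (h : ∀ X, ρ X = w → Guarded X E) :
    Term.Guarded (E.toTerm ρ) w := by
  induction E generalizing W with
  | nil => trivial
  | var Y => exact fun e => h Y e rfl
  | pre a E ih =>
    by_cases ha : a = .tau
    · exact .inr (ih fun X hX => (h X hX).resolve_left fun h => h ha)
    · exact .inl ha
  | sum E F ihE ihF => exact ⟨ihE fun X hX => (h X hX).1, ihF fun X hX => (h X hX).2⟩
  | mu Y E ih =>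
    refine ih (w := some w) fun X hX => ?_
    by_cases hXY : X = Y
    · subst hXY
      simp at hX
    · simp only [Function.update_of_ne hXY, Function.comp, Option.some.injEq] at hX
      exact (h X hX).resolve_left fun h => hXY h.symm

variable [Infinite V]

/-- The binder chosen by `subst` is not free in any substituted expression, so extending the
assignment at that binder acts on these expressions as a weakening. -/
theorem toTerm_subst {W' : Type u} (E : PExpr V A) {σ : V → PExpr V A} {ρ : V → W} {ρ' : V → W'}
    {θ : W → Term A W'} (h : ∀ X ∈ fv E, θ (ρ X) = (σ X).toTerm ρ') :
    (E.subst σ).toTerm ρ' = (E.toTerm ρ).bind θ := by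
  induction E generalizing W W' σ with
  | nil => rfl
  | var X => exact (h X (Finset.mem_singleton_self X)).symm
  | pre a E ih => exact congrArg (Term.pre a) (ih h)
  | sum E F ihE ihF =>
    exact congrArg₂ Term.sum (ihE fun X hX => h X (Finset.mem_union_left _ hX))
      (ihF fun X hX => h X (Finset.mem_union_right _ hX))
  | mu X E ih =>
    simp only [subst]
    set s := ((fv E).erase X).biUnion fun W => fv (σ W) with hs
    set Z := if X ∈ s then fresh s else X with hZ
    have hZs : Z ∉ s := by
      rw [hZ]
      split_ifs with hX
      exacts [fresh_notMem s, hX]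
    refine congrArg Term.mu (ih fun Y hY => ?_)
    by_cases hYX : Y = X
    · subst hYX
      simp [toTerm, Term.up]
    · have hY' : Y ∈ (fv E).erase X := Finset.mem_erase.2 ⟨hYX, hY⟩
      simp only [Function.update_of_ne hYX, Function.comp, Term.up]
      rw [h Y hY', toTerm_rename]
      refine toTerm_congr _ fun U hU => ?_
      have hUZ : U ≠ Z := by
        rintro rfl
        exact hZs (Finset.mem_biUnion.2 ⟨Y, hY', hU⟩)
      simp [hUZ]

theorem toTerm_subst1 {W' : Type u} (E : PExpr V A) {X : V} {F : PExpr V A} {ρ : V → W}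
    {ρ' : V → W'} {θ : W → Term A W'} (h0 : θ (ρ X) = F.toTerm ρ')
    (h : ∀ Y ∈ fv E, Y ≠ X → θ (ρ Y) = .var (ρ' Y)) :
    (E.subst1 X F).toTerm ρ' = (E.toTerm ρ).bind θ := by
  refine toTerm_subst E fun Y hY => ?_
  by_cases hYX : Y = X
  · subst hYX
    simpa using h0
  · simpa [hYX, toTerm] using h Y hY hYX

theorem toTerm_subst1_inst (E : PExpr V A) (X : V) (F : PExpr V A) (ρ : V → W) :
    (E.subst1 X F).toTerm ρ =
      (E.toTerm (Function.update (some ∘ ρ) X none)).inst (F.toTerm ρ) :=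
  toTerm_subst1 E (by simp [Term.single]) fun Y _ hY => by simp [hY, Term.single]

theorem Step.toTerm {E E' : PExpr V A} {a : Act A} (h : Step E a E') (ρ : V → W) :
    Term.Step (E.toTerm ρ) a (E'.toTerm ρ) := by
  induction h with
  | pre a E => exact .pre _ _
  | sum_left _ ih => exact .sum_left ih
  | sum_right _ ih => exact .sum_right ih
  | mu _ ih =>
    rw [toTerm_subst1_inst] at ih
    exact .mu ih

theorem Exposes.toTerm {E : PExpr V A} {X : V} (h : Exposes E X) (ρ : V → W) :
    Term.Exposes (E.toTerm ρ) (ρ X) := by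
  induction h with
  | var X => exact .var _
  | sum_left _ ih => exact .sum_left ih
  | sum_right _ ih => exact .sum_right ih
  | mu _ ih =>
    rw [toTerm_subst1_inst] at ih
    exact .mu ih

/-- The translation keeps the head constructor and sends the raw unfolding of a recursion to the
unfolding of its translation, so a derivation for the term can be rebuilt on raw expressions. -/
theorem exists_step_of_toTerm {E : PExpr V A} {ρ : V → W} {a : Act A} {K : Term A W}
    (h : Term.Step (E.toTerm ρ) a K) : ∃ E', Step E a E' ∧ E'.toTerm ρ = K := by
  generalize hU : E.toTerm ρ = U at h
  induction h generalizing V with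
  | pre a G =>
    cases E with
    | pre b E => cases hU; exact ⟨E, .pre _ _, rfl⟩
    | _ => cases hU
  | sum_left _ ih =>
    cases E with
    | sum E F =>
      cases hU
      obtain ⟨E', h, e⟩ := ih rfl
      exact ⟨E', .sum_left h, e⟩
    | _ => cases hU
  | sum_right _ ih =>
    cases E with
    | sum E F =>
      cases hU
      obtain ⟨E', h, e⟩ := ih rfl
      exact ⟨E', .sum_right h, e⟩
    | _ => cases hU
  | mu _ ih =>
    cases E with
    | mu X E =>
      cases hU
      obtain ⟨E', h, e⟩ := ih (toTerm_subst1_inst E X (mu X E) ρ)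
      exact ⟨E', .mu h, e⟩
    | _ => cases hU

theorem exists_exposes_of_toTerm {E : PExpr V A} {ρ : V → W} {w : W}
    (h : Term.Exposes (E.toTerm ρ) w) : ∃ X, Exposes E X ∧ ρ X = w := by
  generalize hU : E.toTerm ρ = U at h
  induction h generalizing V with
  | var w =>
    cases E with
    | var X => cases hU; exact ⟨X, .var X, rfl⟩
    | _ => cases hU
  | sum_left _ ih =>
    cases E with
    | sum E F =>
      cases hU
      obtain ⟨X, h, e⟩ := ih rfl
      exact ⟨X, .sum_left h, e⟩
    | _ => cases hU
  | sum_right _ ih =>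
    cases E with
    | sum E F =>
      cases hU
      obtain ⟨X, h, e⟩ := ih rfl
      exact ⟨X, .sum_right h, e⟩
    | _ => cases hU
  | mu _ ih =>
    cases E with
    | mu Y E =>
      cases hU
      obtain ⟨X, h, e⟩ := ih (toTerm_subst1_inst E Y (mu Y E) ρ)
      exact ⟨X, .mu h, e⟩
    | _ => cases hU

theorem TauStar.toTerm {E E' : PExpr V A} (h : TauStar E E') (ρ : V → W) :
    ReflTransGen Term.Tau (E.toTerm ρ) (E'.toTerm ρ) :=
  h.lift (fun E => PExpr.toTerm E ρ) fun _ _ hs => Step.toTerm hs ρ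

theorem exists_tauStar_of_toTerm {E : PExpr V A} {ρ : V → W} {K : Term A W}
    (h : ReflTransGen Term.Tau (E.toTerm ρ) K) : ∃ E', TauStar E E' ∧ E'.toTerm ρ = K := by
  induction h with
  | refl => exact ⟨E, .refl, rfl⟩
  | tail _ hs ih =>
    obtain ⟨E', h1, rfl⟩ := ih
    obtain ⟨E'', h2, rfl⟩ := exists_step_of_toTerm hs
    exact ⟨E'', h1.tail h2, rfl⟩

theorem WeakExposes.toTerm {E : PExpr V A} {X : V} (h : WeakExposes E X) (ρ : V → W) :
    Term.WeakExposes (E.toTerm ρ) (ρ X) := by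
  obtain ⟨E', h1, h2⟩ := h
  exact ⟨_, TauStar.toTerm h1 ρ, Exposes.toTerm h2 ρ⟩

/-- The pullback of bisimilarity along the translation is a bisimulation. The identity assignment is
used so that exposed variables keep their names. -/
theorem divBranchingBisimilar_of_toTerm {E F : PExpr V A}
    (h : Term.Bisimilar (E.toTerm id) (F.toTerm id)) : DivBranchingBisimilar E F := by
  refine ⟨fun E F => Term.Bisimilar (E.toTerm id) (F.toTerm id), ⟨fun E F h => h.symm, ?_⟩, h⟩
  intro E F h
  refine ⟨⟨fun a E' hs => ?_, fun X hX => ?_⟩, fun r hr => ?_⟩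
  · rcases Term.progress_bisimilar.step h (Step.toTerm hs id) with
      ⟨ha, K, h1, h2, h3⟩ | ⟨K, K', h1, h2, h3, h4⟩
    · obtain ⟨F', h1', rfl⟩ := exists_tauStar_of_toTerm h1
      exact .inl ⟨ha, F', h1', h2, h3⟩
    · obtain ⟨F', h1', rfl⟩ := exists_tauStar_of_toTerm h1
      obtain ⟨F'', h2', rfl⟩ := exists_step_of_toTerm h2
      exact .inr ⟨F', F'', h1', h2', h3, h4⟩
  · obtain ⟨K, h1, h2, h3⟩ := Term.progress_bisimilar.exposes h (Exposes.toTerm hX id)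
    obtain ⟨F', h1', rfl⟩ := exists_tauStar_of_toTerm h1
    obtain ⟨Y, h3', rfl⟩ := exists_exposes_of_toTerm h3
    exact ⟨F', h1', h2, h3'⟩
  · obtain ⟨j, K, h1, h2⟩ := Term.progress_bisimilar.run h (fun i => (r i).toTerm id)
      (by rw [hr.1]) fun i => Step.toTerm (hr.2 i) id
    obtain ⟨L, h3, h4⟩ := TransGen.head'_iff.1 h1
    obtain ⟨F', h3', rfl⟩ := exists_step_of_toTerm h3
    obtain ⟨F'', h4', rfl⟩ := exists_tauStar_of_toTerm h4
    exact ⟨j, F'', ⟨F', h3', h4'⟩, h2⟩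

theorem divBranchingCongruent_of_toTerm {E F : PExpr V A}
    (h : Term.Cong (E.toTerm id) (F.toTerm id)) : DivBranchingCongruent E F := by
  refine ⟨fun a E' hs => ?_, fun a F' hs => ?_, fun X => ⟨fun hX => ?_, fun hX => ?_⟩⟩
  · obtain ⟨K, h1, h2⟩ := h.left.step (Step.toTerm hs id)
    obtain ⟨F', h1', rfl⟩ := exists_step_of_toTerm h1
    exact ⟨F', h1', divBranchingBisimilar_of_toTerm h2⟩
  · obtain ⟨K, h1, h2⟩ := h.right.step (Step.toTerm hs id)
    obtain ⟨E', h1', rfl⟩ := exists_step_of_toTerm h1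
    exact ⟨E', h1', divBranchingBisimilar_of_toTerm h2.symm⟩
  · obtain ⟨Y, h1, rfl⟩ := exists_exposes_of_toTerm (h.left.exposes (Exposes.toTerm hX id))
    exact h1
  · obtain ⟨Y, h1, rfl⟩ := exists_exposes_of_toTerm (h.right.exposes (Exposes.toTerm hX id))
    exact h1

/-- The assignment is arbitrary because replacement under a binder needs the induction hypothesis
for an extended one. -/
theorem cong_toTerm {E F : PExpr V A} (h : Provable E F) (ρ : V → W) :
    Term.Cong (E.toTerm ρ) (F.toTerm ρ) := by
  induction h generalizing W with
  | refl E => exact .refl _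
  | symm _ ih => exact (ih ρ).symm
  | trans _ _ ih ih' => exact (ih ρ).trans (ih' ρ)
  | congr_pre a _ ih => exact .pre a (ih ρ).bisimilar
  | congr_sum_left D _ ih => exact (ih ρ).sum (.refl _)
  | congr_sum_right D _ ih => exact .sum (.refl _) (ih ρ)
  | congr_mu X _ ih => exact (ih _).mu
  | S1 E F => exact .sum_comm _ _
  | S2 E F G => exact .sum_assoc _ _ _
  | S3 E => exact .sum_idem _
  | S4 E => exact .sum_nil _
  | B a E F => exact .branching _ _ _
  | R0 X Y E hY =>
    have e : (E.subst1 X (var Y)).toTerm (Function.update (some ∘ ρ) Y none) =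
        (E.toTerm (Function.update (some ∘ ρ) X none)).bind Term.var := by
      refine toTerm_subst1 E (by simp [PExpr.toTerm]) fun Z hZ hZX => ?_
      have hZY : Z ≠ Y := by
        rintro rfl
        exact hY (Finset.mem_erase.2 ⟨hZX, hZ⟩)
      simp [hZX, hZY]
    simp only [PExpr.toTerm, e, Term.bind_var]
    exact .refl _
  | R1 X E =>
    rw [toTerm_subst1_inst]
    exact .mu_unfold _
  | R2 X E F hE _ ih =>
    have hF := ih ρ
    rw [toTerm_subst1_inst] at hF
    -- Both `F` and the recursion solve the same guarded equation.
    refine .of_solutions (guarded_toTerm E fun Y hY => ?_) hF (.mu_unfold _)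
    by_cases hYX : Y = X
    · exact hYX ▸ hE
    · simp [hYX] at hY
  | R3 X E =>
    simp only [PExpr.toTerm, Function.update_self]
    exact .mu_sum_var _
  | R4 X E F G hE =>
    refine .mu_tau_tau ?_
    simpa using WeakExposes.toTerm hE (Function.update (some ∘ ρ) X none)
  | R5 X Y E F hXY hE =>
    simp only [PExpr.toTerm, Function.update_self]
    refine .mu_tau_mu ?_
    -- Since `X ≠ Y`, the inner binder does not shadow `X`, whose index is therefore `some none`.
    simpa [hXY] using WeakExposes.toTerm hE
      (Function.update (some ∘ Function.update (some ∘ ρ) X none) Y none)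
  | R6 X E =>
    have e : (E.subst1 X (pre .tau (var X))).toTerm (Function.update (some ∘ ρ) X none) =
        (E.toTerm (Function.update (some ∘ ρ) X none)).bind
          fun o => o.elim (.pre .tau (.var none)) fun w => .var (some w) :=
      toTerm_subst1 E (by simp [PExpr.toTerm]) fun Y _ hY => by simp [hY]
    simp only [PExpr.toTerm, e]
    exact .mu_pre_tau _ rfl fun _ => rfl
  | R7 X Y E =>
    simp only [PExpr.toTerm, Function.update_self]
    exact .mu_tau_loop _
  | R8 X Y E F =>
    by_cases hXY : X = Y
    -- When the two names coincide, the two sides are literally equal.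
    · subst hXY
      exact .refl _
    · simp only [PExpr.toTerm, Function.update_self, Function.update_of_ne hXY, Function.comp]
      exact .mu_mu_sum_var _ _

end Translation

end PExpr

end FiniteState

theorem mainTheorem2 {V : Type*} {A : Type*} [DecidableEq V] [Infinite V]
    (E F : FiniteState.PExpr V A) (h : FiniteState.Provable E F) :
    FiniteState.DivBranchingCongruent E F :=
  FiniteState.PExpr.divBranchingCongruent_of_toTerm (FiniteState.PExpr.cong_toTerm h id)
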